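/- Let $X$ be a finite set. An \emph{$X$-digraph} $\Gamma$ is a directed graph, with loops and multiple edges allowed, whose edges carry labels in $X$. Paths in $\Gamma$ may traverse edges in either direction, traversing an edge labelled $x$ backwards contributing the letter $x^{-1}$; a path is \emph{reduced} if no edge in it is immediately followed by its inverse. $\Gamma$ is \emph{folded} if for every vertex $v$ and every $x\in X$ there is at most one edge labelled $x$ with origin $v$ and at most one edge labelled $x$ with terminus $v$. For a vertex $v$, $\mathrm{Core}(\Gamma,v)$ is the union of the reduced paths from $v$ to $v$ (including the trivial one), as a subgraph; $\Gamma$ is a \emph{core graph with respect to $v$} if $\mathrm{Core}(\Gamma,v)=\Gamma$. For such $\Gamma$ put $\mathrm{Type}(\Gamma)=\bigcap_{u\in V\Gamma}\mathrm{Core}(\Gamma,u)$. The product $\Gamma\times\Delta$ has vertex set $V\Gamma\times V\Delta$, and an edge labelled $x$ from $(o(e),o(f))$ to $(t(e),t(f))$ for each pair of edges $(e,f)$ of $\Gamma$ and $\Delta$ that both have label $x$. A \emph{cycle} is a nontrivial closed path, with edges traversed in either direction, that repeats no edge and, except for its end being its start, no vertex. Let $F$ be a free group with finite basis $X$. For a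 subgroup $H\le F$ let $(\Gamma(H),1_H)$ be the folded $X$-digraph with base vertex, unique up to isomorphism, that is a core graph with respect to $1_H$ and in which the labels of the reduced paths from $1_H$ to $1_H$ are exactly the reduced words representing elements of $H$; concretely, $\Gamma(H)$ is the core at the coset $H$ of the graph of right cosets of $H$ in $F$, with an edge labelled $x$ from $Hg$ to $Hgx$ for every coset $Hg$ and every $x\in X$. \textbf{Proposition.} Let $H$ and $K$ be finitely generated subgroups of $F$. Then the graphs $\mathrm{Type}(\Gamma(H))$, $\mathrm{Type}(\Gamma(K))$ and $\mathrm{Type}(\Gamma(H))\times\mathrm{Type}(\Gamma(K))$ are finite, and there is a nontrivial element of $F$ that is conjugate both to an element of $H$ and to an element of $K$ if and only if $\mathrm{Type}(\Gamma(H))\times\mathrm{Type}(\Gamma(K))$ has a cycle. Moreover, this question is decidable: there is an algorithm that, given $n\in\mathbb N$ and two finite lists of words in $x_1^{\pm1},\dots,x_n^{\pm1}$, decides whether in a free group with basis $x_1,\dots,x_n$ there is a nontrivial element that is conjugate both to an element of the subgroup generated by the first list and to an element of the subgroup generated by the second list. -/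

import Mathlib

universe u v w

/-- An `X`-digraph: a directed graph whose edges `e` have an origin `o e`, a terminus `t e` and
a label `μ e` in the alphabet `X`. -/
structure XDigraph (X : Type u) where
  V : Type v
  E : Type w
  o : E → V
  t : E → V
  μ : E → X

namespace XDigraph

variable {X : Type u}

section Basic

variable (Γ : XDigraph.{u, v, w} X)

/-- The graph is finite. -/
def IsFinite : Prop := Finite Γ.V ∧ Finite Γ.E

/-- The edges of the graph with formal inverses added: `(e, true)` is `e` and `(e, false)` is
the inverse edge. This is the convention of `FreeGroup` for letters, where `(x, true)` is `x` and
`(x, false)` is the inverse of `x`. -/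
abbrev OEdge : Type w := Γ.E × Bool

variable {Γ}

/-- The origin of an edge or inverse edge. -/
def src : Γ.OEdge → Γ.V
  | (e, true) => Γ.o e
  | (e, false) => Γ.t e

/-- The terminus of an edge or inverse edge. -/
def tgt : Γ.OEdge → Γ.V
  | (e, true) => Γ.t e
  | (e, false) => Γ.o e

/-- The label of an edge or inverse edge. -/
def label (a : Γ.OEdge) : X × Bool := (Γ.μ a.1, a.2)

/-- The inverse of an edge or inverse edge. -/
def inv (a : Γ.OEdge) : Γ.OEdge := (a.1, !a.2)

/-- `p` is a path from `x` to `y`. The empty list is the trivial path at the vertex `x = y`. -/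
def IsPath : Γ.V → List Γ.OEdge → Γ.V → Prop
  | x, [], y => x = y
  | x, a :: p, y => src a = x ∧ IsPath (tgt a) p y

/-- A path is reduced if no edge in it is followed by its inverse. -/
def IsReducedPath (p : List Γ.OEdge) : Prop := p.IsChain fun a b => b ≠ inv a

/-- The label of a path, as a word over `X` and the inverses of its letters. -/
def word (p : List Γ.OEdge) : List (X × Bool) := p.map label

variable (Γ)

/-- The language of `Γ` with respect to `x`: the labels of the reduced paths from `x` to `x`. -/
def language (x : Γ.V) : Set (List (X × Bool)) :=
  {l | ∃ p : List Γ.OEdge, IsPath x p x ∧ IsReducedPath p ∧ word p = l}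

/-- Folded: for every vertex and label there is at most one edge with that origin and label, and
at most one edge with that terminus and label. -/
def IsFolded : Prop :=
  (∀ e f : Γ.E, Γ.o e = Γ.o f → Γ.μ e = Γ.μ f → e = f) ∧
    ∀ e f : Γ.E, Γ.t e = Γ.t f → Γ.μ e = Γ.μ f → e = f

/-- A cycle at `x`: a nontrivial closed path (edges may be traversed in either direction) that
repeats no edge and, apart from its end being its start, no vertex. A loop is a cycle of length
one, and two edges with the same pair of distinct endpoints form a cycle of length two. -/
def IsCycle (x : Γ.V) (p : List Γ.OEdge) : Prop :=
  p ≠ [] ∧ IsPath x p x ∧ (p.map Prod.fst).Nodup ∧ (p.map src).Nodup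

/-- The graph contains a cycle. -/
def HasCycle : Prop := ∃ (x : Γ.V) (p : List Γ.OEdge), Γ.IsCycle x p

/-- A subgraph of an `X`-digraph. -/
structure Sub where
  verts : Set Γ.V
  edges : Set Γ.E
  o_mem : ∀ e ∈ edges, Γ.o e ∈ verts
  t_mem : ∀ e ∈ edges, Γ.t e ∈ verts

variable {Γ}

/-- A subgraph as an `X`-digraph in its own right. -/
abbrev Sub.toXDigraph (S : Γ.Sub) : XDigraph.{u, v, w} X where
  V := S.verts
  E := S.edges
  o e := ⟨Γ.o e, S.o_mem e e.2⟩
  t e := ⟨Γ.t e, S.t_mem e e.2⟩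
  μ e := Γ.μ e

variable (Γ)

/-- The core of `Γ` at `x`: the union, over all reduced paths `p` from `x` to `x`, of the
subgraph consisting of the positive edges corresponding to edges of `p` and their endpoints
(of the vertex `x` alone, if `p` is trivial). -/
def core (x : Γ.V) : Γ.Sub where
  verts := {y | ∃ p : List Γ.OEdge, IsPath x p x ∧ IsReducedPath p ∧
    (y = x ∨ ∃ a ∈ p, y = src a ∨ y = tgt a)}
  edges := {e | ∃ p : List Γ.OEdge, IsPath x p x ∧ IsReducedPath p ∧ ∃ a ∈ p, a.1 = e}
  o_mem := by
    rintro _ ⟨p, hp, hr, ⟨e, b⟩, ha, rfl⟩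
    refine ⟨p, hp, hr, Or.inr ⟨(e, b), ha, ?_⟩⟩
    cases b <;> simp [src, tgt]
  t_mem := by
    rintro _ ⟨p, hp, hr, ⟨e, b⟩, ha, rfl⟩
    refine ⟨p, hp, hr, Or.inr ⟨(e, b), ha, ?_⟩⟩
    cases b <;> simp [src, tgt]

/-- `Γ` is a core graph with respect to `x`: its core at `x` is all of `Γ`. -/
def IsCore (x : Γ.V) : Prop := (Γ.core x).verts = Set.univ ∧ (Γ.core x).edges = Set.univ

/-- The type of a core graph: the intersection of its cores at all of its vertices. -/
def type : XDigraph.{u, v, w} X :=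
  Sub.toXDigraph (Γ := Γ)
    { verts := ⋂ x, (Γ.core x).verts
      edges := ⋂ x, (Γ.core x).edges
      o_mem := fun e he => Set.mem_iInter.2 fun x => (Γ.core x).o_mem e (Set.mem_iInter.1 he x)
      t_mem := fun e he => Set.mem_iInter.2 fun x => (Γ.core x).t_mem e (Set.mem_iInter.1 he x) }

end Basic

/-- The product of two `X`-digraphs. -/
def prod (Γ Δ : XDigraph.{u, v, w} X) : XDigraph.{u, v, w} X where
  V := Γ.V × Δ.V
  E := {a : Γ.E × Δ.E // Γ.μ a.1 = Δ.μ a.2}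
  o a := (Γ.o a.1.1, Δ.o a.1.2)
  t a := (Γ.t a.1.1, Δ.t a.1.2)
  μ a := Γ.μ a.1.1

/-- The coset graph of a subgroup `H` of the free group on `X`. The vertices are the right cosets
`H g`, where `H g` is represented by the left coset of `g⁻¹` (so the vertex `1` is `H`); for every
vertex `H g` and letter `x` there is an edge labelled `x` from `H g` to `H (g x)`. -/
abbrev cosetGraph (H : Subgroup (FreeGroup X)) : XDigraph.{u, u, u} X where
  V := FreeGroup X ⧸ H
  E := (FreeGroup X ⧸ H) × X
  o e := e.1
  t e := (FreeGroup.of e.2)⁻¹ • e.1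
  μ e := e.2

/-- The vertex `H` of the coset graph. -/
def cosetGraphBase (H : Subgroup (FreeGroup X)) : (cosetGraph H).V :=
  ((1 : FreeGroup X) : FreeGroup X ⧸ H)

/-- The graph `Γ(H)` of a subgroup `H` of the free group on `X`: the core of the coset graph at
the coset `H`. -/
def subgroupGraph (H : Subgroup (FreeGroup X)) : XDigraph.{u, u, u} X :=
  ((cosetGraph H).core (cosetGraphBase H)).toXDigraph

/-- The base vertex of `Γ(H)`. -/
def subgroupGraphBase (H : Subgroup (FreeGroup X)) : (subgroupGraph H).V :=
  ⟨cosetGraphBase H, [], rfl, List.isChain_nil, Or.inl rfl⟩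

/-! `Γ(H)` is folded, a core graph with respect to its base vertex, and its language there is the
set of freely reduced words that represent elements of `H`. -/

section Facts

variable {Γ : XDigraph.{u, v, w} X}

/-- The inclusion of a subgraph on edges and inverse edges. -/
def Sub.incl (S : Γ.Sub) (a : S.toXDigraph.OEdge) : Γ.OEdge := (a.1.1, a.2)

theorem Sub.incl_injective (S : Γ.Sub) : Function.Injective S.incl := by
  rintro ⟨⟨e, he⟩, b⟩ ⟨⟨f, hf⟩, c⟩ h
  simp only [Sub.incl, Prod.mk.injEq] at h
  obtain ⟨rfl, rfl⟩ := h
  rfl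

theorem Sub.src_incl (S : Γ.Sub) (a : S.toXDigraph.OEdge) : src (S.incl a) = (src (Γ := S.toXDigraph) a).1 := by
  rcases a with ⟨e, _ | _⟩ <;> rfl

theorem Sub.tgt_incl (S : Γ.Sub) (a : S.toXDigraph.OEdge) : tgt (S.incl a) = (tgt (Γ := S.toXDigraph) a).1 := by
  rcases a with ⟨e, _ | _⟩ <;> rfl

theorem Sub.isPath_map (S : Γ.Sub) (p : List S.toXDigraph.OEdge) (x y : S.verts) :
    IsPath (Γ := Γ) x (p.map S.incl) y ↔ IsPath (Γ := S.toXDigraph) x p y := by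
  induction p generalizing x with
  | nil => exact Subtype.ext_iff.symm
  | cons a p ih =>
    simp only [List.map_cons, IsPath, Sub.src_incl, Sub.tgt_incl]
    exact and_congr Subtype.ext_iff.symm (ih _)

theorem Sub.isReducedPath_map (S : Γ.Sub) (p : List S.toXDigraph.OEdge) :
    IsReducedPath (Γ := Γ) (p.map S.incl) ↔ IsReducedPath p := by
  unfold IsReducedPath
  rw [List.isChain_map]
  have : ∀ a b : S.toXDigraph.OEdge, S.incl b ≠ inv (S.incl a) ↔ b ≠ inv a :=
    fun a b => not_congr (S.incl_injective.eq_iff (a := b) (b := inv a))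
  simp only [this]

theorem Sub.word_map (S : Γ.Sub) (p : List S.toXDigraph.OEdge) :
    word (Γ := Γ) (p.map S.incl) = word p := by
  simp only [word, List.map_map]
  rfl

theorem Sub.exists_lift (S : Γ.Sub) (p : List Γ.OEdge) (h : ∀ a ∈ p, a.1 ∈ S.edges) :
    ∃ q : List S.toXDigraph.OEdge, q.map S.incl = p := by
  induction p with
  | nil => exact ⟨[], rfl⟩
  | cons a p ih =>
    obtain ⟨q, rfl⟩ := ih fun b hb => h b (List.mem_cons_of_mem _ hb)
    exact ⟨(⟨a.1, h a List.mem_cons_self⟩, a.2) :: q, rfl⟩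

theorem Sub.isFolded (S : Γ.Sub) (h : Γ.IsFolded) : S.toXDigraph.IsFolded :=
  ⟨fun e f ho hm => Subtype.ext (h.1 e.1 f.1 (congrArg Subtype.val ho) hm),
    fun e f ho hm => Subtype.ext (h.2 e.1 f.1 (congrArg Subtype.val ho) hm)⟩

theorem exists_lift_core (x : Γ.V) (hx : x ∈ (Γ.core x).verts) (p : List Γ.OEdge)
    (hp : IsPath x p x) (hr : IsReducedPath p) :
    ∃ q : List (Γ.core x).toXDigraph.OEdge, q.map (Γ.core x).incl = p ∧
      IsPath (Γ := (Γ.core x).toXDigraph) ⟨x, hx⟩ q ⟨x, hx⟩ ∧ IsReducedPath q := by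
  obtain ⟨q, rfl⟩ := (Γ.core x).exists_lift p fun a ha => ⟨p, hp, hr, a, ha, rfl⟩
  exact ⟨q, rfl, ((Γ.core x).isPath_map q ⟨x, hx⟩ ⟨x, hx⟩).1 hp,
    ((Γ.core x).isReducedPath_map q).1 hr⟩

theorem core_isCore (x : Γ.V) (hx : x ∈ (Γ.core x).verts) :
    (Γ.core x).toXDigraph.IsCore ⟨x, hx⟩ := by
  constructor
  · rw [Set.eq_univ_iff_forall]
    rintro ⟨y, p, hp, hr, hy⟩
    obtain ⟨q, rfl, hq, hqr⟩ := exists_lift_core x hx p hp hr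
    refine ⟨q, hq, hqr, ?_⟩
    rcases hy with rfl | ⟨a, ha, h⟩
    · exact Or.inl rfl
    · obtain ⟨c, hc, rfl⟩ := List.mem_map.1 ha
      rw [Sub.src_incl, Sub.tgt_incl] at h
      exact Or.inr ⟨c, hc, h.imp (fun h => Subtype.ext h) (fun h => Subtype.ext h)⟩
  · rw [Set.eq_univ_iff_forall]
    rintro ⟨e, p, hp, hr, a, ha, rfl⟩
    obtain ⟨q, rfl, hq, hqr⟩ := exists_lift_core x hx p hp hr
    obtain ⟨c, hc, rfl⟩ := List.mem_map.1 ha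
    exact ⟨q, hq, hqr, c, hc, rfl⟩

theorem language_core (x : Γ.V) (hx : x ∈ (Γ.core x).verts) :
    (Γ.core x).toXDigraph.language ⟨x, hx⟩ = Γ.language x := by
  ext l
  constructor
  · rintro ⟨q, hq, hr, rfl⟩
    exact ⟨q.map (Γ.core x).incl, ((Γ.core x).isPath_map q ⟨x, hx⟩ ⟨x, hx⟩).2 hq,
      ((Γ.core x).isReducedPath_map q).2 hr, (Γ.core x).word_map q⟩
  · rintro ⟨p, hp, hr, rfl⟩
    obtain ⟨q, rfl, hq, hqr⟩ := exists_lift_core x hx p hp hr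
    exact ⟨q, hq, hqr, ((Γ.core x).word_map q).symm⟩

theorem cosetGraph_isFolded (H : Subgroup (FreeGroup X)) : (cosetGraph H).IsFolded := by
  constructor
  · rintro ⟨q, x⟩ ⟨r, y⟩ h h'
    exact Prod.ext h h'
  · rintro ⟨q, x⟩ ⟨r, y⟩ h h'
    obtain rfl : x = y := h'
    exact Prod.ext (MulAction.injective (FreeGroup.of x)⁻¹ h) rfl

theorem isReduced_word_iff (h : Γ.IsFolded) (p : List Γ.OEdge) (x y : Γ.V) (hp : IsPath x p y) :
    FreeGroup.IsReduced (word p) ↔ IsReducedPath p := by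
  induction p generalizing x with
  | nil => simp [word, IsReducedPath]
  | cons a p ih =>
    obtain ⟨-, hp⟩ := hp
    have ih := ih _ hp
    cases p with
    | nil => simp [word, IsReducedPath]
    | cons c p =>
      have key : ((label a).1 = (label c).1 → (label a).2 = (label c).2) ↔ c ≠ inv a := by
        obtain ⟨e, b⟩ := a
        obtain ⟨f, d⟩ := c
        have hs := hp.1
        constructor
        · rintro h1 h2
          simp only [inv, Prod.mk.injEq] at h2
          obtain ⟨rfl, rfl⟩ := h2
          simpa [label] using h1 rfl
        · intro h1 h2
          by_contra h3
          apply h1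
          change Γ.μ e = Γ.μ f at h2
          change b ≠ d at h3
          change _ = (e, !b)
          cases b <;> cases d <;> simp_all [src, tgt]
          · exact h.1 f e hs h2.symm
          · exact h.2 f e hs h2.symm
      simp only [word, List.map_cons, FreeGroup.IsReduced, IsReducedPath,
        List.isChain_cons_cons] at ih ⊢
      rw [ih, key]

theorem isPath_cosetGraph (H : Subgroup (FreeGroup X)) (p : List (cosetGraph H).OEdge)
    (x y : FreeGroup X ⧸ H) (hp : IsPath (Γ := cosetGraph H) x p y) :
    y = (FreeGroup.mk (word p))⁻¹ • x := by
  induction p generalizing x with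
  | nil =>
    obtain rfl : x = y := hp
    change x = (1 : FreeGroup X)⁻¹ • x
    rw [inv_one, one_smul]
  | cons a p ih =>
    obtain ⟨rfl, hp⟩ := hp
    rw [ih _ hp]
    have hw : FreeGroup.mk (word (a :: p)) = FreeGroup.mk [label a] * FreeGroup.mk (word p) := rfl
    have ha : ∀ a : (cosetGraph H).OEdge, (tgt a : FreeGroup X ⧸ H) =
        (FreeGroup.mk [label a])⁻¹ • (src a : FreeGroup X ⧸ H) := by
      rintro ⟨⟨q, z⟩, _ | _⟩
      · exact (smul_inv_smul (FreeGroup.of z) q).symm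
      · rfl
    rw [hw, mul_inv_rev]
    exact (congrArg ((FreeGroup.mk (word p))⁻¹ • ·) (ha a)).trans (smul_smul _ _ _)

theorem exists_path_cosetGraph (H : Subgroup (FreeGroup X)) (l : List (X × Bool))
    (x : FreeGroup X ⧸ H) : ∃ (p : List (cosetGraph H).OEdge) (y : FreeGroup X ⧸ H),
      IsPath (Γ := cosetGraph H) x p y ∧ word p = l := by
  induction l generalizing x with
  | nil => exact ⟨[], x, rfl, rfl⟩
  | cons a l ih =>
    obtain ⟨z, _ | _⟩ := a
    · obtain ⟨p, y, hp, rfl⟩ := ih (FreeGroup.of z • x)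
      exact ⟨((FreeGroup.of z • x, z), false) :: p, y,
        ⟨inv_smul_smul (FreeGroup.of z) x, hp⟩, rfl⟩
    · obtain ⟨p, y, hp, rfl⟩ := ih ((FreeGroup.of z)⁻¹ • x)
      exact ⟨((x, z), true) :: p, y, ⟨rfl, hp⟩, rfl⟩

theorem language_cosetGraph (H : Subgroup (FreeGroup X)) :
    (cosetGraph H).language (cosetGraphBase H) =
      {l | FreeGroup.IsReduced l ∧ FreeGroup.mk l ∈ H} := by
  have key : ∀ l : List (X × Bool), (FreeGroup.mk l)⁻¹ • ((1 : FreeGroup X) : FreeGroup X ⧸ H) =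
      ((1 : FreeGroup X) : FreeGroup X ⧸ H) ↔ FreeGroup.mk l ∈ H := by
    intro l
    rw [MulAction.Quotient.smul_coe, eq_comm, QuotientGroup.eq, inv_one, one_mul, smul_eq_mul,
      mul_one, inv_mem_iff]
  ext l
  constructor
  · rintro ⟨p, hp, hr, rfl⟩
    exact ⟨(isReduced_word_iff (cosetGraph_isFolded H) p _ _ hp).2 hr,
      (key _).1 (isPath_cosetGraph H p _ _ hp).symm⟩
  · rintro ⟨hl, hm⟩
    obtain ⟨p, y, hp, rfl⟩ := exists_path_cosetGraph H l (1 : FreeGroup X)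
    have hy := isPath_cosetGraph H p _ _ hp
    rw [(key _).2 hm] at hy
    subst hy
    exact ⟨p, hp, (isReduced_word_iff (cosetGraph_isFolded H) p _ _ hp).1 hl, rfl⟩

theorem subgroupGraph_spec (H : Subgroup (FreeGroup X)) :
    (subgroupGraph H).IsFolded ∧ (subgroupGraph H).IsCore (subgroupGraphBase H) ∧
      (subgroupGraph H).language (subgroupGraphBase H) =
        {l | FreeGroup.IsReduced l ∧ FreeGroup.mk l ∈ H} :=
  ⟨Sub.isFolded _ (cosetGraph_isFolded H), core_isCore _ _,
    (language_core _ _).trans (language_cosetGraph H)⟩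

end Facts

/-- The graph `Γ(H)` of a subgroup `H` of a free group `F` with basis `b`, where `F` is identified
with the free group on `X` by means of `b`. -/
def subgroupGraphOfBasis {F : Type v} [Group F] (b : FreeGroupBasis X F) (H : Subgroup F) :
    XDigraph.{u, u, u} X :=
  subgroupGraph (H.map b.repr.toMonoidHom)

end XDigraph

/-- Some nontrivial element of `F` is conjugate both to an element of `H` and to an element
of `K`. -/
def HaveCommonConjugate {F : Type v} [Group F] (H K : Subgroup F) : Prop :=
  ∃ g : F, g ≠ 1 ∧ (∃ h ∈ H, IsConj g h) ∧ ∃ k ∈ K, IsConj g k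

/-- The subgroup generated by the elements that a finite list of words over the basis (and its
inverses) represents. -/
def subgroupOfWords {F : Type v} [Group F] {X : Type u} (b : FreeGroupBasis X F)
    (A : List (List (X × Bool))) : Subgroup F :=
  Subgroup.closure {g | ∃ l ∈ A, g = b.repr.symm (FreeGroup.mk l)}

/-- Words over the letters `0, …, n - 1`, as an input for an algorithm. -/
def natWords {n : ℕ} (A : List (List (Fin n × Bool))) : List (List (ℕ × Bool)) :=
  A.map (List.map fun a => ((a.1 : ℕ), a.2))

/-! Reading a word `w` in the coset graph of `H` carries a coset `x` to `w⁻¹ • x`. Hence closed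
paths labelled `w` sit exactly at the cosets fixed by `w`, and such a coset exists if and only if
`w` represents a conjugate of an element of `H` (`exists_smul_eq_iff_isConj`).

A nontrivial common conjugate may be replaced by a nonempty cyclically reduced word `w`. A closed
path `p` with such a label lies in the core at every vertex `x` joined to it: take a reduced path
`s` from `x` to `p`; whenever `s p s⁻¹` backtracks, rotating `p` by one edge shortens `s`
(`exists_reduced_conj`, `mem_core_edges`). Used at the base coset this puts `p` in `Γ(H)`, and used
at all vertices of `Γ(H)` it puts `p` in the type. The closed paths labelled `w` in the two types
combine to one in the product, which is reduced because `w` is, and a nontrivial reduced closed path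
contains a cycle (`hasCycle_of_isPath`). Conversely, a cycle is a reduced path; the product is
folded, so its label is a nonempty reduced word and represents a nontrivial element, and its two
projections are closed paths that give fixed cosets for `H` and `K`.

Finiteness: in the coset graph, the finitely many edges on closed paths that spell the generators
already carry every reduced closed path at the base, since foldedness makes a path the only one with
its label and origin.

Decidability: by Post's theorem it is enough that the property and its negation are recursively
enumerable. The property is witnessed by a conjugator and two products of generators. The negation
is witnessed by two finite folded graphs that read the generators, together with a rank on the
oriented edges of their product that decreases along reduced paths and so excludes cyclically
reduced closed paths. -/

namespace XDigraph

/-! ### Paths, reduction, cores and cycles -/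

section Paths

variable {X : Type u} {Γ : XDigraph.{u, v, w} X}

theorem src_inv (a : Γ.OEdge) : src (inv a) = tgt a := by
  rcases a with ⟨e, _ | _⟩ <;> rfl

theorem tgt_inv (a : Γ.OEdge) : tgt (inv a) = src a := by
  rcases a with ⟨e, _ | _⟩ <;> rfl

theorem inv_inv (a : Γ.OEdge) : inv (inv a) = a := by
  rcases a with ⟨e, _ | _⟩ <;> rfl

theorem label_inv (a : Γ.OEdge) : label (inv a) = ((label a).1, !(label a).2) := rfl

/-- The inverse of a path. -/
def invPath (p : List Γ.OEdge) : List Γ.OEdge := (p.map inv).reverse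

theorem word_append (p q : List Γ.OEdge) : word (p ++ q) = word p ++ word q := by
  simp [word]

theorem word_invPath (p : List Γ.OEdge) : word (invPath p) = FreeGroup.invRev (word p) := by
  simp [word, invPath, FreeGroup.invRev, label_inv, Function.comp_def]

theorem isPath_append (p q : List Γ.OEdge) (x y : Γ.V) :
    IsPath x (p ++ q) y ↔ ∃ z, IsPath x p z ∧ IsPath z q y := by
  induction p generalizing x with
  | nil => simp [IsPath]
  | cons a p ih => simp [IsPath, ih, and_assoc]

theorem IsPath.append {p q : List Γ.OEdge} {x y z : Γ.V} (hp : IsPath x p y) (hq : IsPath y q z) :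
    IsPath x (p ++ q) z :=
  (isPath_append p q x z).2 ⟨y, hp, hq⟩

theorem IsPath.invPath {p : List Γ.OEdge} {x y : Γ.V} (hp : IsPath x p y) :
    IsPath y (invPath p) x := by
  induction p generalizing x with
  | nil => exact Eq.symm hp
  | cons a p ih =>
    obtain ⟨rfl, hp⟩ := hp
    have : XDigraph.invPath (a :: p) = XDigraph.invPath p ++ [inv a] := by simp [XDigraph.invPath]
    rw [this]
    exact (ih hp).append ⟨src_inv a, tgt_inv a⟩

theorem IsPath.end_unique {p : List Γ.OEdge} {x y z : Γ.V} (hy : IsPath x p y)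
    (hz : IsPath x p z) : y = z := by
  induction p generalizing x with
  | nil => exact Eq.trans (Eq.symm hy) hz
  | cons a p ih => exact ih hy.2 hz.2

theorem IsPath.rotate {p : List Γ.OEdge} {x : Γ.V} (hp : IsPath x p x) (n : ℕ) :
    ∃ y, IsPath y (p.rotate n) y := by
  induction n generalizing p x with
  | zero => exact ⟨x, by simpa using hp⟩
  | succ n ih =>
    cases p with
    | nil => exact ⟨x, by simpa using hp⟩
    | cons a p =>
      rw [List.rotate_cons_succ]
      obtain ⟨rfl, hp⟩ := hp
      exact ih (hp.append ⟨rfl, rfl⟩)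

theorem exists_isPath_of_isRotated {p : List Γ.OEdge} {x : Γ.V} (hp : IsPath x p x)
    {w : List (X × Bool)} (hw : word p ~r w) :
    ∃ (y : Γ.V) (q : List Γ.OEdge), IsPath y q y ∧ word q = w := by
  obtain ⟨n, rfl⟩ := hw
  obtain ⟨y, hy⟩ := hp.rotate n
  exact ⟨y, p.rotate n, hy, by simp [word]⟩

/-- In a folded graph a path is determined by its origin and its label. -/
theorem IsPath.eq_of_word_eq (h : Γ.IsFolded) {p q : List Γ.OEdge} {x y z : Γ.V}
    (hp : IsPath x p y) (hq : IsPath x q z) (hw : word p = word q) : p = q := by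
  induction p generalizing x q with
  | nil => cases q with
    | nil => rfl
    | cons b q => simp [word] at hw
  | cons a p ih => cases q with
    | nil => simp [word] at hw
    | cons b q =>
      simp only [word, List.map_cons, List.cons.injEq] at hw
      have hab : a = b := by
        obtain ⟨e, c⟩ := a
        obtain ⟨f, d⟩ := b
        have hs : src (e, c) = src (f, d) := hp.1.trans hq.1.symm
        obtain ⟨hl, -⟩ := hw
        simp only [label, Prod.mk.injEq] at hl
        obtain ⟨hl, rfl⟩ := hl
        cases c
        · rw [h.2 e f hs hl]
        · rw [h.1 e f hs hl]
      subst hab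
      rw [ih hp.2 hq.2 hw.2]

/-- Every path can be reduced without changing its endpoints and the element it represents. -/
theorem IsPath.exists_reduced {p : List Γ.OEdge} {x y : Γ.V} (hp : IsPath x p y) :
    ∃ q : List Γ.OEdge, IsPath x q y ∧ IsReducedPath q ∧ q ⊆ p ∧
      FreeGroup.mk (word q) = FreeGroup.mk (word p) := by
  induction p generalizing x with
  | nil => exact ⟨[], hp, List.isChain_nil, fun _ h => h, rfl⟩
  | cons a p ih =>
    obtain ⟨rfl, hp⟩ := hp
    obtain ⟨q, hq, hr, hs, hw⟩ := ih hp
    have hw' : FreeGroup.mk (word (a :: q)) = FreeGroup.mk (word (a :: p)) :=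
      congrArg (FreeGroup.mk [label a] * ·) hw
    cases q with
    | nil => exact ⟨[a], ⟨rfl, hq⟩, List.isChain_singleton a, by simp, hw'⟩
    | cons b q =>
      by_cases hb : b = inv a
      · subst hb
        refine ⟨q, ?_, hr.tail, ?_, ?_⟩
        · have := hq.2
          rwa [tgt_inv] at this
        · exact fun c hc => List.mem_cons_of_mem _ (hs (List.mem_cons_of_mem _ hc))
        · rw [← hw']
          exact (Quot.sound FreeGroup.Red.Step.cons_not).symm
      · exact ⟨a :: b :: q, ⟨rfl, hq⟩, List.isChain_cons_cons.2 ⟨hb, hr⟩,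
          List.cons_subset_cons a hs, hw'⟩

theorem isReducedPath_of_isReduced_word {p : List Γ.OEdge} (h : FreeGroup.IsReduced (word p)) :
    IsReducedPath p := by
  rw [FreeGroup.IsReduced, word, List.isChain_map] at h
  refine h.imp fun a b hab hb => ?_
  subst hb
  simpa [label_inv] using hab rfl

theorem isReducedPath_invPath {p : List Γ.OEdge} (h : IsReducedPath p) :
    IsReducedPath (invPath p) := by
  rw [IsReducedPath, invPath, List.isChain_reverse, List.isChain_map]
  refine h.imp fun a b hab hb => hab ?_
  rw [hb, inv_inv]

/-- The elements of a subgroup that is generated by labels of closed paths with edges in a given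
set are represented by such closed paths. -/
theorem exists_isPath_of_mem_closure (x : Γ.V) (E : Set Γ.E) (S : Set (FreeGroup X))
    (hS : ∀ s ∈ S, ∃ p : List Γ.OEdge, IsPath x p x ∧ (∀ a ∈ p, a.1 ∈ E) ∧
      FreeGroup.mk (word p) = s) (h : FreeGroup X) (hh : h ∈ Subgroup.closure S) :
    ∃ p : List Γ.OEdge, IsPath x p x ∧ (∀ a ∈ p, a.1 ∈ E) ∧ FreeGroup.mk (word p) = h := by
  induction hh using Subgroup.closure_induction with
  | mem s hs => exact hS s hs
  | one => exact ⟨[], rfl, by simp, rfl⟩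
  | mul g h _ _ hg hh =>
    obtain ⟨p, hp, hpE, rfl⟩ := hg
    obtain ⟨q, hq, hqE, rfl⟩ := hh
    refine ⟨p ++ q, hp.append hq, ?_, by rw [word_append, FreeGroup.mul_mk]⟩
    simpa [or_imp, forall_and] using And.intro hpE hqE
  | inv g _ hg =>
    obtain ⟨p, hp, hpE, rfl⟩ := hg
    refine ⟨invPath p, hp.invPath, ?_, by rw [word_invPath, FreeGroup.inv_mk]⟩
    intro a ha
    simp only [invPath, List.mem_reverse, List.mem_map] at ha
    obtain ⟨b, hb, rfl⟩ := ha
    exact hpE b hb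

theorem eq_of_mk_eq {l m : List (X × Bool)} (hl : FreeGroup.IsReduced l)
    (hm : FreeGroup.IsReduced m) (h : FreeGroup.mk l = FreeGroup.mk m) : l = m := by
  classical
  rw [← hl.reduce_eq, ← hm.reduce_eq]
  exact FreeGroup.reduce.sound h

/-- A closed path with cyclically reduced label can, after a rotation, be conjugated by a path
without creating backtracking. -/
theorem exists_reduced_conj (s p : List Γ.OEdge) {x y : Γ.V} (hs : IsPath x s y)
    (hr : IsReducedPath s) (hp : IsPath y p y) (hne : p ≠ [])
    (hc : (p : Cycle Γ.OEdge).Chain fun a b => b ≠ inv a) :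
    ∃ (t q : List Γ.OEdge) (z : Γ.V), q ~r p ∧ IsPath x t z ∧ IsPath z q z ∧
      IsReducedPath (t ++ (q ++ invPath t)) := by
  have hred : ∀ q : List Γ.OEdge, ((q : Cycle Γ.OEdge).Chain fun a b => b ≠ inv a) →
      IsReducedPath q := by
    rintro (_ | ⟨a, q⟩) h
    · exact List.isChain_nil
    · rw [Cycle.chain_coe_cons, ← List.cons_append] at h
      exact h.left_of_append
  induction s using List.reverseRecOn generalizing p y with
  | nil => exact ⟨[], p, y, List.IsRotated.refl p, hs, hp, by simpa [invPath] using hred p hc⟩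
  | append_singleton s c ih =>
    obtain ⟨z, hs', hz, rfl⟩ := (isPath_append _ _ _ _).1 hs
    subst hz
    have hr' : IsReducedPath s := hr.left_of_append
    -- If `p` starts by undoing `c`, moving that edge to its end gives a closed path based where `s`
    -- ends, so `c` can be dropped from the conjugator.
    by_cases h1 : p.head? = some (inv c)
    · obtain ⟨p, rfl⟩ : ∃ p', p = inv c :: p' := by
        cases p with
        | nil => simp at h1
        | cons a p => exact ⟨p, by simpa using h1⟩
      have hrot : p ++ [inv c] ~r inv c :: p := List.IsRotated.symm ⟨1, by simp⟩
      obtain ⟨t, q, z, hq, h⟩ := ih (p ++ [inv c]) hs' hr'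
        (by have := hp.2; rw [tgt_inv] at this; exact this.append ⟨src_inv c, tgt_inv c⟩) (by simp)
        (by rw [Cycle.coe_eq_coe.2 hrot]; exact hc)
      exact ⟨t, q, z, hq.trans hrot, h⟩
    -- The mirror case: `p` ends with `c`, and the inverse conjugator would begin by undoing it. If
    -- neither case occurs, both junctions are reduced.
    by_cases h2 : p.getLast? = some c
    · obtain ⟨p, rfl⟩ := List.getLast?_eq_some_iff.1 h2
      have hrot : c :: p ~r p ++ [c] := ⟨1, by simp⟩
      obtain ⟨z, hz, hz', -⟩ := (isPath_append _ _ _ _).1 hp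
      subst hz'
      obtain ⟨t, q, z, hq, h⟩ := ih (c :: p) hs' hr' ⟨rfl, hz⟩ (by simp)
        (by rw [Cycle.coe_eq_coe.2 hrot]; exact hc)
      exact ⟨t, q, z, hq.trans hrot, h⟩
    refine ⟨s ++ [c], p, tgt c, List.IsRotated.refl p, hs, hp, ?_⟩
    refine List.isChain_append.2 ⟨hr, List.isChain_append.2 ⟨hred p hc, isReducedPath_invPath hr, ?_⟩, ?_⟩
    · intro a ha b hb
      simp only [invPath, List.map_append, List.map_cons, List.map_nil, List.reverse_append,
        List.reverse_singleton, List.singleton_append, List.head?_cons, Option.mem_some_iff] at hb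
      subst hb
      rintro h
      apply h2
      have := congrArg inv h
      rw [inv_inv, inv_inv] at this
      rwa [this]
    · intro a ha b hb
      simp only [List.getLast?_append, List.getLast?_singleton, Option.some_or,
        Option.mem_some_iff] at ha
      subst ha
      rw [List.head?_append_of_ne_nil _ hne] at hb
      rintro rfl
      exact h1 hb

/-- An edge followed by its inverse, also around the end of the path, would give two cancelling
letters. Foldedness is needed only for the opposite implication. -/
theorem chain_of_isCyclicallyReduced_word {p : List Γ.OEdge}
    (h : FreeGroup.IsCyclicallyReduced (word p)) :
    (p : Cycle Γ.OEdge).Chain fun a b => b ≠ inv a := by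
  have h' : ((word p : List (X × Bool)) : Cycle (X × Bool)).Chain
      fun a b => a.1 = b.1 → a.2 = b.2 := by
    generalize word p = l at h
    cases l with
    | nil => trivial
    | cons a l =>
      rw [Cycle.chain_coe_cons, ← List.cons_append, List.isChain_append]
      refine ⟨h.1, List.isChain_singleton a, fun b hb c hc => ?_⟩
      exact h.2 b hb c (by simpa using hc)
  rw [word, ← Cycle.map_coe, Cycle.chain_map] at h'
  refine h'.imp fun a b hab hb => ?_
  subst hb
  simpa [label_inv] using hab rfl

/-- The edges of a cyclically reduced closed path are in the core at every vertex that is joined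
to it by a path. -/
theorem mem_core_edges (s p : List Γ.OEdge) {x y : Γ.V} (hs : IsPath x s y)
    (hp : IsPath y p y) (hc : (p : Cycle Γ.OEdge).Chain fun a b => b ≠ inv a) :
    ∀ a ∈ p, a.1 ∈ (Γ.core x).edges := by
  intro a ha
  obtain ⟨s', hs', hr, -⟩ := hs.exists_reduced
  obtain ⟨t, q, z, hq, ht, hz, hred⟩ :=
    exists_reduced_conj s' p hs' hr hp (List.ne_nil_of_mem ha) hc
  exact ⟨_, ht.append (hz.append ht.invPath), hred, a, by simp [hq.mem_iff, ha], rfl⟩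

theorem IsPath.exists_isPath_src {p : List Γ.OEdge} {x y : Γ.V} (hp : IsPath x p y) {a : Γ.OEdge}
    (ha : a ∈ p) : ∃ q : List Γ.OEdge, IsPath x q (src a) := by
  obtain ⟨l, m, rfl⟩ := List.append_of_mem ha
  obtain ⟨z, hz, rfl, -⟩ := (isPath_append _ _ _ _).1 hp
  exact ⟨l, hz⟩

/-- A core graph is connected. -/
theorem IsCore.exists_isPath {b : Γ.V} (h : Γ.IsCore b) (x y : Γ.V) :
    ∃ p : List Γ.OEdge, IsPath x p y := by
  have key : ∀ x, ∃ p : List Γ.OEdge, IsPath b p x := by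
    intro x
    obtain ⟨p, hp, -, rfl | ⟨a, ha, rfl | rfl⟩⟩ := Set.eq_univ_iff_forall.1 h.1 x
    · exact ⟨[], rfl⟩
    · exact hp.exists_isPath_src ha
    · obtain ⟨q, hq⟩ := hp.exists_isPath_src ha
      exact ⟨q ++ [a], hq.append ⟨rfl, rfl⟩⟩
  obtain ⟨p, hp⟩ := key x
  obtain ⟨q, hq⟩ := key y
  exact ⟨_, hp.invPath.append hq⟩

/-- A nontrivial path with edges in a subgraph lifts to the subgraph. -/
theorem Sub.exists_lift_closed (S : Γ.Sub) {p : List Γ.OEdge} {x : Γ.V} (hp : IsPath x p x)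
    (hne : p ≠ []) (h : ∀ a ∈ p, a.1 ∈ S.edges) :
    ∃ (y : S.verts) (q : List S.toXDigraph.OEdge), IsPath (Γ := S.toXDigraph) y q y ∧
      word q = word p := by
  obtain ⟨q, rfl⟩ := S.exists_lift p h
  have hx : x ∈ S.verts := by
    cases q with
    | nil => simp at hne
    | cons a q =>
      have := hp.1
      rw [S.src_incl] at this
      exact this ▸ Subtype.property _
  exact ⟨⟨x, hx⟩, q, (S.isPath_map q ⟨x, hx⟩ ⟨x, hx⟩).1 hp, (S.word_map q).symm⟩

/-- A core graph is connected, so `mem_core_edges` puts the whole path in the core at every vertex,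
that is, in the type. -/
theorem exists_isPath_type {b : Γ.V} (h : Γ.IsCore b) {p : List Γ.OEdge} {x : Γ.V}
    (hp : IsPath x p x) (hne : p ≠ []) (hc : FreeGroup.IsCyclicallyReduced (word p)) :
    ∃ (y : Γ.type.V) (q : List Γ.type.OEdge), IsPath y q y ∧ word q = word p := by
  refine Sub.exists_lift_closed _ hp hne fun a ha => Set.mem_iInter.2 fun u => ?_
  obtain ⟨s, hs⟩ := h.exists_isPath u x
  exact mem_core_edges s p hs hp (chain_of_isCyclicallyReduced_word hc) a ha

theorem type_isFolded (h : Γ.IsFolded) : Γ.type.IsFolded := Sub.isFolded _ h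

theorem type_isFinite (h : Γ.IsFinite) : Γ.type.IsFinite := by
  obtain ⟨_, _⟩ := h
  exact ⟨Subtype.finite, Subtype.finite⟩

theorem exists_split_of_not_nodup {α β : Type*} (f : α → β) (l : List α)
    (h : ¬ (l.map f).Nodup) :
    ∃ (l₁ : List α) (a : α) (l₂ : List α) (b : α) (l₃ : List α),
      l = l₁ ++ (a :: l₂ ++ b :: l₃) ∧ f a = f b := by
  induction l with
  | nil => simp at h
  | cons c l ih =>
    by_cases hc : f c ∈ l.map f
    · obtain ⟨b, hb, hbc⟩ := List.mem_map.1 hc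
      obtain ⟨l₂, l₃, rfl⟩ := List.append_of_mem hb
      exact ⟨[], c, l₂, b, l₃, rfl, hbc.symm⟩
    · rw [List.map_cons, List.nodup_cons, not_and] at h
      obtain ⟨l₁, a, l₂, b, l₃, rfl, hab⟩ := ih (h hc)
      exact ⟨c :: l₁, a, l₂, b, l₃, rfl, hab⟩

/-- A nontrivial reduced closed path contains a cycle. -/
theorem hasCycle_of_isPath (p : List Γ.OEdge) (x : Γ.V) (hp : IsPath x p x)
    (hr : IsReducedPath p) (hne : p ≠ []) : Γ.HasCycle := by
  by_cases hv : (p.map src).Nodup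
  · refine ⟨x, p, hne, hp, ?_, hv⟩
    -- As no source repeats, a repeated edge is traversed once in each direction. If the traversals
    -- are adjacent the path backtracks; otherwise the vertex right after the first one is also the
    -- source of the second, a repetition.
    by_contra he
    obtain ⟨l₁, a, l₂, b, l₃, rfl, hab⟩ := exists_split_of_not_nodup _ _ he
    have hne : a ≠ b := by
      rintro rfl
      simp [List.nodup_append] at hv
    have hb : b = inv a := by
      obtain ⟨e, c⟩ := a
      obtain ⟨f, d⟩ := b
      obtain rfl : e = f := hab
      cases c <;> cases d <;> simp_all [inv]
    obtain ⟨z, -, -, hz⟩ := (isPath_append _ _ _ _).1 hp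
    cases l₂ with
    | nil =>
      have := (List.isChain_append.1 hr).2.1
      exact (List.isChain_cons_cons.1 this).1 hb
    | cons c l₂ =>
      have h1 : src c = src b := hz.1.trans (by rw [hb, src_inv])
      simp [List.nodup_append, h1] at hv
  -- The segment between two visits to a vertex is closed, reduced, nontrivial and shorter, since it
  -- omits `b`.
  · obtain ⟨l₁, a, l₂, b, l₃, rfl, hab⟩ := exists_split_of_not_nodup _ _ hv
    obtain ⟨z, -, hz⟩ := (isPath_append _ _ _ _).1 hp
    obtain ⟨z', hz', rfl, -⟩ := (isPath_append _ _ _ _).1 hz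
    have hza : src a = z := hz'.1
    rw [← hza, ← hab] at hz'
    exact hasCycle_of_isPath (a :: l₂) (src a) hz'
      (List.isChain_append.1 (List.isChain_append.1 hr).2.1).1 (by simp)
termination_by p.length
decreasing_by
  subst_vars
  simp only [List.length_append, List.length_cons]
  omega

end Paths

/-! ### Products: paths with equal labels -/

section Prod

variable {X : Type u} {Γ Δ : XDigraph.{u, v, w} X}

theorem prod_isFinite (h : Γ.IsFinite) (h' : Δ.IsFinite) : (Γ.prod Δ).IsFinite := by
  obtain ⟨_, _⟩ := h
  obtain ⟨_, _⟩ := h'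
  exact ⟨inferInstanceAs (Finite (Γ.V × Δ.V)),
    inferInstanceAs (Finite {a : Γ.E × Δ.E // Γ.μ a.1 = Δ.μ a.2})⟩

theorem prod_isFolded (h : Γ.IsFolded) (h' : Δ.IsFolded) : (Γ.prod Δ).IsFolded := by
  constructor
  · rintro ⟨⟨e, f⟩, he⟩ ⟨⟨e', f'⟩, he'⟩ ho hm
    obtain ⟨h1, h2⟩ := Prod.ext_iff.1 ho
    exact Subtype.ext (Prod.ext (h.1 e e' h1 hm) (h'.1 f f' h2 (he.symm.trans (hm.trans he'))))
  · rintro ⟨⟨e, f⟩, he⟩ ⟨⟨e', f'⟩, he'⟩ ho hm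
    obtain ⟨h1, h2⟩ := Prod.ext_iff.1 ho
    exact Subtype.ext (Prod.ext (h.2 e e' h1 hm) (h'.2 f f' h2 (he.symm.trans (hm.trans he'))))

/-- Equal labels force the two paths to traverse equally labelled edges in the same direction at
each step, and such pairs are the oriented edges of the product. -/
theorem exists_isPath_prod (p : List Γ.OEdge) (q : List Δ.OEdge) {x x' : Γ.V} {y y' : Δ.V}
    (hp : IsPath x p x') (hq : IsPath y q y') (h : word p = word q) :
    ∃ r : List (Γ.prod Δ).OEdge, IsPath (Γ := Γ.prod Δ) (x, y) r (x', y') ∧ word r = word p := by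
  induction p generalizing q x y with
  | nil => cases q with
    | nil => exact ⟨[], Prod.ext hp hq, rfl⟩
    | cons b q => simp [word] at h
  | cons a p ih => cases q with
    | nil => simp [word] at h
    | cons b q =>
      simp only [word, List.map_cons, List.cons.injEq] at h
      obtain ⟨rfl, hp⟩ := hp
      obtain ⟨rfl, hq⟩ := hq
      obtain ⟨r, hr, hw⟩ := ih q hp hq h.2
      obtain ⟨e, c⟩ := a
      obtain ⟨f, d⟩ := b
      obtain ⟨hl, -⟩ := h
      simp only [label, Prod.mk.injEq] at hl
      obtain ⟨hl, rfl⟩ := hl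
      refine ⟨(⟨(e, f), hl⟩, c) :: r, ?_, congrArg ((Γ.μ e, c) :: ·) hw⟩
      cases c <;> exact ⟨rfl, hr⟩

theorem exists_isPath_of_prod (r : List (Γ.prod Δ).OEdge) {x x' : Γ.V} {y y' : Δ.V}
    (hr : IsPath (Γ := Γ.prod Δ) (x, y) r (x', y')) :
    (∃ p : List Γ.OEdge, IsPath x p x' ∧ word p = word r) ∧
      ∃ q : List Δ.OEdge, IsPath y q y' ∧ word q = word r := by
  induction r generalizing x y with
  | nil => exact ⟨⟨[], congrArg Prod.fst hr, rfl⟩, [], congrArg Prod.snd hr, rfl⟩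
  | cons a r ih =>
    obtain ⟨⟨⟨e, f⟩, hl⟩, c⟩ := a
    obtain ⟨hs, hr⟩ := hr
    have key : ∀ {s t}, src (Γ := Γ.prod Δ) (⟨(e, f), hl⟩, c) = s →
        tgt (Γ := Γ.prod Δ) (⟨(e, f), hl⟩, c) = t →
        (src (Γ := Γ) (e, c) = s.1 ∧ tgt (Γ := Γ) (e, c) = t.1) ∧
          src (Γ := Δ) (f, c) = s.2 ∧ tgt (Γ := Δ) (f, c) = t.2 := by
      rintro s t rfl rfl
      cases c <;> exact ⟨⟨rfl, rfl⟩, rfl, rfl⟩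
    obtain ⟨⟨h1, h2⟩, h3, h4⟩ := key hs rfl
    obtain ⟨⟨p, hp, hpw⟩, q, hq, hqw⟩ := ih hr
    refine ⟨⟨(e, c) :: p, ⟨h1, h2 ▸ hp⟩, congrArg ((Γ.μ e, c) :: ·) hpw⟩,
      (f, c) :: q, ⟨h3, h4 ▸ hq⟩, ?_⟩
    change (Δ.μ f, c) :: word q = (Γ.μ e, c) :: word r
    rw [hqw, ← hl]

end Prod

end XDigraph

/-! ### Conjugacy into a subgroup as a fixed point on cosets -/

/-- The coset of `a` is fixed by `g⁻¹` exactly when `a⁻¹ * g * a ∈ H`. -/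
theorem exists_smul_eq_iff_isConj {G : Type*} [Group G] (H : Subgroup G) (g : G) :
    (∃ x : G ⧸ H, g⁻¹ • x = x) ↔ ∃ h ∈ H, IsConj g h := by
  constructor
  · rintro ⟨x, hx⟩
    induction x using QuotientGroup.induction_on with
    | H a =>
      rw [MulAction.Quotient.smul_coe, QuotientGroup.eq] at hx
      refine ⟨a⁻¹ * g * a, by simpa [mul_assoc] using hx, isConj_iff.2 ⟨a⁻¹, by simp⟩⟩
  · rintro ⟨h, hh, hc⟩
    obtain ⟨c, rfl⟩ := isConj_iff.1 hc
    refine ⟨((c⁻¹ : G) : G ⧸ H), ?_⟩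
    rw [MulAction.Quotient.smul_coe, QuotientGroup.eq]
    simpa [mul_assoc] using hh

theorem haveCommonConjugate_iff {G : Type*} [Group G] (H K : Subgroup G) :
    HaveCommonConjugate H K ↔
      ∃ g : G, g ≠ 1 ∧ (∃ x : G ⧸ H, g⁻¹ • x = x) ∧ ∃ y : G ⧸ K, g⁻¹ • y = y := by
  simp only [HaveCommonConjugate, exists_smul_eq_iff_isConj]

/-- Nontriviality has to survive only on `H`, because `g` is conjugate to an element of `H`. This
lets `f` be a retraction that is far from injective. -/
theorem HaveCommonConjugate.map {G G' : Type*} [Group G] [Group G'] {H K : Subgroup G}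
    (h : HaveCommonConjugate H K) (f : G →* G') (hf : ∀ g ∈ H, g ≠ 1 → f g ≠ 1) :
    HaveCommonConjugate (H.map f) (K.map f) := by
  obtain ⟨g, hg, ⟨a, ha, hga⟩, b, hb, hgb⟩ := h
  refine ⟨f g, ?_, ⟨f a, ⟨a, ha, rfl⟩, f.map_isConj hga⟩, f b, ⟨b, hb, rfl⟩, f.map_isConj hgb⟩
  have ha1 : a ≠ 1 := by
    rintro rfl
    exact hg (isConj_one_left.1 hga)
  intro h1
  have := f.map_isConj hga
  rw [h1] at this
  exact hf a ha ha1 (isConj_one_right.1 this)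

/-! ### Common conjugates and cycles in the product of types; finiteness -/

namespace XDigraph

variable {X : Type u}

/-- A word that fixes a coset labels a closed path at that coset. -/
theorem exists_isPath_of_smul_eq (H : Subgroup (FreeGroup X)) (w : List (X × Bool))
    (x : FreeGroup X ⧸ H) (hx : (FreeGroup.mk w)⁻¹ • x = x) :
    ∃ p : List (cosetGraph H).OEdge, IsPath (Γ := cosetGraph H) x p x ∧ word p = w := by
  obtain ⟨p, y, hp, rfl⟩ := exists_path_cosetGraph H w x
  have hy := isPath_cosetGraph H p _ _ hp
  rw [hx] at hy
  exact ⟨p, hy ▸ hp, rfl⟩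

theorem exists_isPath_base (H : Subgroup (FreeGroup X)) (x : FreeGroup X ⧸ H) :
    ∃ p : List (cosetGraph H).OEdge, IsPath (Γ := cosetGraph H) (cosetGraphBase H) p x := by
  classical
  induction x using QuotientGroup.induction_on with
  | H a =>
    obtain ⟨p, y, hp, hw⟩ := exists_path_cosetGraph H (FreeGroup.toWord a⁻¹) (1 : FreeGroup X)
    have hy := isPath_cosetGraph H p _ _ hp
    rw [hw, FreeGroup.mk_toWord, _root_.inv_inv, MulAction.Quotient.smul_coe, smul_eq_mul,
      mul_one] at hy
    exact ⟨p, hy ▸ hp⟩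

/-- The core argument is used twice: at the base coset to descend from the coset graph to `Γ(H)`,
then at every vertex of `Γ(H)` to descend to the type. -/
theorem exists_isPath_subgroupGraph_type (H : Subgroup (FreeGroup X)) {w : List (X × Bool)}
    (hne : w ≠ []) (hc : FreeGroup.IsCyclicallyReduced w)
    (h : ∃ x : FreeGroup X ⧸ H, (FreeGroup.mk w)⁻¹ • x = x) :
    ∃ (y : (subgroupGraph H).type.V) (q : List (subgroupGraph H).type.OEdge),
      IsPath y q y ∧ word q = w := by
  obtain ⟨x, hx⟩ := h
  obtain ⟨p, hp, rfl⟩ := exists_isPath_of_smul_eq H w x hx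
  have hne' : p ≠ [] := by rintro rfl; exact hne rfl
  obtain ⟨s, hs⟩ := exists_isPath_base H x
  obtain ⟨y, q, hq, hw⟩ := Sub.exists_lift_closed
    ((cosetGraph H).core (cosetGraphBase H)) hp hne'
    (mem_core_edges s p hs hp (chain_of_isCyclicallyReduced_word hc))
  rw [← hw] at hc hne ⊢
  exact exists_isPath_type (subgroupGraph_spec H).2.1 hq (by rintro rfl; exact hne rfl) hc

theorem smul_eq_of_isPath_subgroupGraph (H : Subgroup (FreeGroup X))
    {x : (subgroupGraph H).V} {p : List (subgroupGraph H).OEdge} (hp : IsPath x p x) :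
    ∃ y : FreeGroup X ⧸ H, (FreeGroup.mk (word p))⁻¹ • y = y := by
  have := (((cosetGraph H).core (cosetGraphBase H)).isPath_map p x x).2 hp
  have h := isPath_cosetGraph H _ _ _ this
  exact ⟨x.1, (h.trans (congrArg (fun l => (FreeGroup.mk l)⁻¹ • (x.1 : FreeGroup X ⧸ H))
    (Sub.word_map _ p))).symm⟩

theorem smul_eq_of_isPath_type (H : Subgroup (FreeGroup X))
    {x : (subgroupGraph H).type.V} {p : List (subgroupGraph H).type.OEdge} (hp : IsPath x p x) :
    ∃ y : FreeGroup X ⧸ H, (FreeGroup.mk (word p))⁻¹ • y = y := by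
  have := (Sub.isPath_map (Γ := subgroupGraph H) _ p x x).2 hp
  exact Eq.mp (congrArg (fun l => ∃ y : FreeGroup X ⧸ H, (FreeGroup.mk l)⁻¹ • y = y)
    (Sub.word_map _ p)) (smul_eq_of_isPath_subgroupGraph H this)

theorem exists_isCyclicallyReduced {H K : Subgroup (FreeGroup X)} (h : HaveCommonConjugate H K) :
    ∃ w : List (X × Bool), w ≠ [] ∧ FreeGroup.IsCyclicallyReduced w ∧
      (∃ x : FreeGroup X ⧸ H, (FreeGroup.mk w)⁻¹ • x = x) ∧
      ∃ y : FreeGroup X ⧸ K, (FreeGroup.mk w)⁻¹ • y = y := by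
  classical
  obtain ⟨g, hg, ⟨a, ha, hga⟩, b, hb, hgb⟩ := h
  set w := FreeGroup.reduceCyclically g.toWord with hw
  have hconj : IsConj (FreeGroup.mk w) g := by
    refine isConj_iff.2 ⟨FreeGroup.mk (FreeGroup.reduceCyclically.conjugator g.toWord), ?_⟩
    rw [FreeGroup.inv_mk, FreeGroup.mul_mk, FreeGroup.mul_mk,
      FreeGroup.reduceCyclically.conj_conjugator_reduceCyclically, FreeGroup.mk_toWord]
  refine ⟨w, ?_, FreeGroup.reduceCyclically.isCyclicallyReduced FreeGroup.isReduced_toWord,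
    (exists_smul_eq_iff_isConj H _).2 ⟨a, ha, hconj.trans hga⟩,
    (exists_smul_eq_iff_isConj K _).2 ⟨b, hb, hconj.trans hgb⟩⟩
  intro h
  rw [h] at hconj
  exact hg (isConj_one_right.1 hconj)

theorem haveCommonConjugate_of_word {H K : Subgroup (FreeGroup X)} {w : List (X × Bool)}
    (hne : w ≠ []) (hr : FreeGroup.IsReduced w)
    (hx : ∃ x : FreeGroup X ⧸ H, (FreeGroup.mk w)⁻¹ • x = x)
    (hy : ∃ y : FreeGroup X ⧸ K, (FreeGroup.mk w)⁻¹ • y = y) : HaveCommonConjugate H K :=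
  (haveCommonConjugate_iff H K).2
    ⟨FreeGroup.mk w, fun h => hne (eq_of_mk_eq hr FreeGroup.IsReduced.nil h), hx, hy⟩

/-- Backtracking would use the same underlying edge twice. -/
theorem isReducedPath_of_isCycle {Γ : XDigraph.{u, v, w} X} {x : Γ.V} {p : List Γ.OEdge}
    (h : Γ.IsCycle x p) : IsReducedPath p := by
  obtain ⟨-, -, h, -⟩ := h
  rw [List.Nodup, List.pairwise_map] at h
  exact h.isChain.imp fun a b hab hb => hab (by rw [hb]; rfl)

theorem haveCommonConjugate_iff_hasCycle (H K : Subgroup (FreeGroup X)) :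
    HaveCommonConjugate H K ↔ ((subgroupGraph H).type.prod (subgroupGraph K).type).HasCycle := by
  constructor
  · intro h
    obtain ⟨w, hne, hc, hx, hy⟩ := exists_isCyclicallyReduced h
    obtain ⟨x, p, hp, hpw⟩ := exists_isPath_subgroupGraph_type H hne hc hx
    obtain ⟨y, q, hq, hqw⟩ := exists_isPath_subgroupGraph_type K hne hc hy
    obtain ⟨r, hr, hrw⟩ := exists_isPath_prod p q hp hq (hpw.trans hqw.symm)
    rw [hpw] at hrw
    refine hasCycle_of_isPath r _ hr (isReducedPath_of_isReduced_word (hrw ▸ hc.1)) ?_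
    rintro rfl
    exact hne hrw.symm
  · rintro ⟨⟨x, y⟩, r, hr⟩
    obtain ⟨⟨p, hp, hpw⟩, q, hq, hqw⟩ := exists_isPath_of_prod r hr.2.1
    have hx := smul_eq_of_isPath_type H hp
    have hy := smul_eq_of_isPath_type K hq
    rw [hpw] at hx
    rw [hqw] at hy
    refine haveCommonConjugate_of_word ?_ ?_ hx hy
    · simpa [word] using hr.1
    · exact (isReduced_word_iff (prod_isFolded (type_isFolded (subgroupGraph_spec H).1)
        (type_isFolded (subgroupGraph_spec K).1)) r _ _ hr.2.1).2 (isReducedPath_of_isCycle hr)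

/-- The graph of a finitely generated subgroup is finite. -/
theorem subgroupGraph_isFinite (H : Subgroup (FreeGroup X)) (hH : H.FG) :
    (subgroupGraph H).IsFinite := by
  classical
  obtain ⟨S, rfl⟩ := hH
  set H := Subgroup.closure (S : Set (FreeGroup X))
  have hfix : ∀ s ∈ H, (FreeGroup.mk s.toWord)⁻¹ • cosetGraphBase H = cosetGraphBase H := by
    intro s hs
    rw [cosetGraphBase, FreeGroup.mk_toWord, MulAction.Quotient.smul_coe, QuotientGroup.eq]
    simpa using hs
  have hpath : ∀ s : S, ∃ p : List (cosetGraph H).OEdge,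
      IsPath (Γ := cosetGraph H) (cosetGraphBase H) p (cosetGraphBase H) ∧
        word p = FreeGroup.toWord s.1 := fun s =>
    exists_isPath_of_smul_eq H _ _ (hfix s (Subgroup.subset_closure s.2))
  choose P hP hPw using hpath
  -- The finitely many edges on the paths that spell the generators; they turn out to contain the
  -- whole core.
  let E : Set (cosetGraph H).E := ⋃ s : S, {e | e ∈ (P s).map Prod.fst}
  have hE : E.Finite := Set.finite_iUnion fun s => List.finite_toSet _
  have key : ∀ p : List (cosetGraph H).OEdge,
      IsPath (Γ := cosetGraph H) (cosetGraphBase H) p (cosetGraphBase H) → IsReducedPath p →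
        ∀ a ∈ p, a.1 ∈ E := by
    intro p hp hr
    have hw := (isReduced_word_iff (cosetGraph_isFolded H) p _ _ hp).2 hr
    have hmem : word p ∈ (cosetGraph H).language (cosetGraphBase H) := ⟨p, hp, hr, rfl⟩
    rw [language_cosetGraph] at hmem
    -- The element read by `p` is also read by a product of generator paths inside `E`. Reducing
    -- that product stays in `E` and yields the same reduced word, hence by foldedness the path `p`
    -- itself.
    obtain ⟨q, hq, hqE, hqw⟩ := exists_isPath_of_mem_closure (Γ := cosetGraph H)
      (cosetGraphBase H) E S (fun s hs => ⟨P ⟨s, hs⟩, hP _, fun a ha =>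
        Set.mem_iUnion.2 ⟨⟨s, hs⟩, List.mem_map_of_mem ha⟩, by
          rw [hPw, FreeGroup.mk_toWord]⟩) _ hmem.2
    obtain ⟨q', hq', hr', hsub, hw'⟩ := hq.exists_reduced
    have := eq_of_mk_eq hw ((isReduced_word_iff (cosetGraph_isFolded H) q' _ _ hq').2 hr')
      (hqw.symm.trans hw'.symm)
    obtain rfl := hp.eq_of_word_eq (cosetGraph_isFolded H) hq' this
    exact fun a ha => hqE a (hsub ha)
  constructor
  · refine Set.Finite.to_subtype (Set.Finite.subset ((Set.finite_singleton (cosetGraphBase H)).union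
      ((hE.image (cosetGraph H).o).union (hE.image (cosetGraph H).t))) ?_)
    rintro y ⟨p, hp, hr, hy⟩
    rcases hy with rfl | ⟨⟨e, b⟩, ha, h⟩
    · exact Or.inl rfl
    · have he : e ∈ E := key p hp hr _ ha
      have ho : (cosetGraph H).o e ∈ (cosetGraph H).o '' E := ⟨e, he, rfl⟩
      have ht : (cosetGraph H).t e ∈ (cosetGraph H).t '' E := ⟨e, he, rfl⟩
      cases b
      · rcases h with rfl | rfl
        · exact Or.inr (Or.inr ht)
        · exact Or.inr (Or.inl ho)
      · rcases h with rfl | rfl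
        · exact Or.inr (Or.inl ho)
        · exact Or.inr (Or.inr ht)
  · refine Set.Finite.to_subtype (hE.subset ?_)
    rintro _ ⟨p, hp, hr, a, ha, rfl⟩
    exact key p hp hr a ha

end XDigraph

theorem haveCommonConjugate_map_mulEquiv {G G' : Type*} [Group G] [Group G'] (e : G ≃* G')
    (H K : Subgroup G) :
    HaveCommonConjugate (H.map e.toMonoidHom) (K.map e.toMonoidHom) ↔
      HaveCommonConjugate H K := by
  constructor
  · intro h
    have := h.map e.symm.toMonoidHom (fun g _ hg => by simpa using hg)
    rw [Subgroup.map_map, Subgroup.map_map] at this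
    simpa using this
  · intro h
    exact h.map e.toMonoidHom (fun g _ hg => by simpa using hg)

namespace XDigraph

/-! ### Folded graphs that read the generators -/

section Reading

variable {X : Type u} {Δ : XDigraph.{u, v, w} X}

/-- If closed paths of a folded graph at a vertex represent the generators of `H`, then every
cyclically reduced word with a fixed point on the cosets of `H` labels a closed path. -/
theorem exists_isPath_of_generators (hΔ : Δ.IsFolded) (r : Δ.V) (S : Set (FreeGroup X))
    (hS : ∀ s ∈ S, ∃ p : List Δ.OEdge, IsPath r p r ∧ FreeGroup.mk (word p) = s)
    {w : List (X × Bool)} (hne : w ≠ []) (hc : FreeGroup.IsCyclicallyReduced w)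
    (h : ∃ x : FreeGroup X ⧸ Subgroup.closure S, (FreeGroup.mk w)⁻¹ • x = x) :
    ∃ (y : Δ.V) (p : List Δ.OEdge), IsPath y p y ∧ word p = w := by
  set H := Subgroup.closure S
  obtain ⟨x, hx⟩ := h
  obtain ⟨p, hp, rfl⟩ := exists_isPath_of_smul_eq H w x hx
  obtain ⟨s, hs⟩ := exists_isPath_base H x
  obtain ⟨s', hs', hr, -⟩ := hs.exists_reduced
  obtain ⟨t, q, z, hq, ht, hz, hred⟩ := exists_reduced_conj s' p hs' hr hp
    (by rintro rfl; exact hne rfl) (chain_of_isCyclicallyReduced_word hc)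
  -- A conjugate of a rotation of `w` is now a reduced word in `H`, so a reduced closed path `Q` of
  -- `Δ` at `r` has precisely this label.
  have hmem : word (t ++ (q ++ invPath t)) ∈ (cosetGraph H).language (cosetGraphBase H) :=
    ⟨_, ht.append (hz.append ht.invPath), hred, rfl⟩
  rw [language_cosetGraph] at hmem
  obtain ⟨P, hP, -, hPw⟩ := exists_isPath_of_mem_closure r Set.univ S
    (fun s hs => (hS s hs).imp fun p hp => ⟨hp.1, fun _ _ => Set.mem_univ _, hp.2⟩) _ hmem.2
  obtain ⟨Q, hQ, hQr, -, hQw⟩ := hP.exists_reduced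
  have hw := eq_of_mk_eq ((isReduced_word_iff hΔ Q _ _ hQ).2 hQr) hmem.1 (hQw.trans hPw)
  rw [word_append, word_append, word_invPath] at hw
  obtain ⟨Q₁, Q', rfl, h₁, hw'⟩ := List.map_eq_append_iff.1 hw
  obtain ⟨Q₂, Q₃, rfl, h₂, h₃⟩ := List.map_eq_append_iff.1 hw'
  obtain ⟨z₁, hz₁, hQ'⟩ := (isPath_append _ _ _ _).1 hQ
  obtain ⟨z₂, hz₂, hz₃⟩ := (isPath_append _ _ _ _).1 hQ'
  -- The first part of `Q` and the inverse of its last part both leave `r` with the label of `t`.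
  -- They coincide by foldedness, so the middle part is closed.
  have hz₃' := hz₃.invPath
  have heq : word (invPath Q₃) = word Q₁ := by
    rw [word_invPath]
    change FreeGroup.invRev (Q₃.map label) = Q₁.map label
    rw [h₁, h₃, FreeGroup.invRev_invRev]
  rw [hz₃'.eq_of_word_eq hΔ hz₁ heq] at hz₃'
  obtain rfl := hz₁.end_unique hz₃'
  refine exists_isPath_of_isRotated hz₂ ?_
  change Q₂.map label ~r p.map label
  rw [h₂]
  exact hq.map label

end Reading

/-! ### Ranks as certificates of acyclicity -/

section Rank

variable {X : Type u} {Δ : XDigraph.{u, v, w} X}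

/-- `b` can follow `a` in a reduced path. -/
def Follows (a b : Δ.OEdge) : Prop := src b = tgt a ∧ b ≠ inv a

theorem exists_isPath_of_transGen {a b : Δ.OEdge} (h : Relation.TransGen Follows a b) :
    ∃ p : List Δ.OEdge, IsPath (src a) (a :: p) (src b) ∧ IsReducedPath (a :: p ++ [b]) := by
  induction h with
  | single h => exact ⟨[], ⟨rfl, h.1.symm⟩, by simpa [IsReducedPath] using h.2⟩
  | @tail b c _ h ih =>
    obtain ⟨p, hp, hr⟩ := ih
    refine ⟨p ++ [b], ?_, ?_⟩
    · rw [← List.cons_append]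
      exact hp.append ⟨rfl, h.1.symm⟩
    · rw [← List.cons_append]
      refine List.isChain_append.2 ⟨hr, List.isChain_singleton c, fun x hx y hy => ?_⟩
      simp only [List.head?_cons, Option.mem_some_iff] at hy
      rw [List.getLast?_append, List.getLast?_singleton, Option.some_or,
        Option.mem_some_iff] at hx
      subst hx hy
      exact h.2

/-- A finite graph without nontrivial reduced closed paths has a rank function on its edges that
decreases along reduced paths. -/
theorem exists_rank [Finite Δ.E]
    (h : ∀ (x : Δ.V) (p : List Δ.OEdge), IsPath x p x → IsReducedPath p → p = []) :
    ∃ Φ : Δ.OEdge → ℕ, ∀ a b, Follows a b → Φ b < Φ a := by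
  -- The rank counts the oriented edges reachable from `a` in at least one step. What `b` reaches,
  -- `a` reaches too, and `b` itself is new: otherwise `b` would lie on a nontrivial reduced closed
  -- path.
  refine ⟨fun a => {b | Relation.TransGen Follows a b}.ncard, fun a b hab => ?_⟩
  refine Set.ncard_lt_ncard ⟨fun c hc => Relation.TransGen.head hab hc, fun hsub => ?_⟩
    (Set.toFinite _)
  obtain ⟨p, hp, hr⟩ := exists_isPath_of_transGen (hsub (Relation.TransGen.single hab))
  exact List.cons_ne_nil _ _ (h _ _ hp hr.left_of_append)

/-- A graph with a rank function that decreases along reduced paths has no nontrivial cyclically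
reduced closed paths. -/
theorem eq_nil_of_rank (Φ : Δ.OEdge → ℕ) (hΦ : ∀ a b, Follows a b → Φ b < Φ a) {x : Δ.V}
    {p : List Δ.OEdge} (hp : IsPath x p x)
    (hc : (p : Cycle Δ.OEdge).Chain fun a b => b ≠ inv a) : p = [] := by
  have hpath : ∀ {p : List Δ.OEdge} {x y}, IsPath x p y → p.IsChain fun a b => src b = tgt a := by
    intro p
    induction p with
    | nil => exact fun _ => List.isChain_nil
    | cons a p ih =>
      intro x y hp
      cases p with
      | nil => exact List.isChain_singleton a
      | cons b p => exact List.isChain_cons_cons.2 ⟨hp.2.1, ih hp.2⟩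
  cases p with
  | nil => rfl
  | cons a p =>
    rw [Cycle.chain_coe_cons] at hc
    -- Going once around and repeating the first edge makes the rank of `a` smaller than itself.
    have h1 : IsPath x (a :: p ++ [a]) (tgt a) := hp.append ⟨hp.1, rfl⟩
    have h2 := hpath h1
    rw [List.cons_append] at h2
    have h3 : (a :: (p ++ [a])).IsChain fun a b => Φ b < Φ a := by
      rw [List.isChain_iff_getElem] at h2 hc ⊢
      exact fun i hi => hΦ _ _ ⟨h2 i hi, hc i hi⟩
    have : IsTrans Δ.OEdge fun a b => Φ b < Φ a := ⟨fun _ _ _ h h' => h'.trans h⟩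
    have h4 := List.isChain_iff_pairwise.1 h3
    exact absurd ((List.pairwise_cons.1 h4).1 a (by simp)) (lt_irrefl _)

end Rank

end XDigraph

/-! ### Finite certificates for the absence of a common conjugate -/

/-- Edges `(o, μ, t)` of graphs with natural numbers as vertices and labels. -/
abbrev NatEdge := ℕ × ℕ × ℕ

namespace NatEdge

/-- The origin of an edge or inverse edge. -/
def src (c : NatEdge × Bool) : ℕ := bif c.2 then c.1.1 else c.1.2.2

/-- The terminus of an edge or inverse edge. -/
def tgt (c : NatEdge × Bool) : ℕ := bif c.2 then c.1.2.2 else c.1.1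

/-- The label of an edge or inverse edge. -/
def label (c : NatEdge × Bool) : ℕ × Bool := (c.1.2.1, c.2)

end NatEdge

/-- The graph with a given list of edges. -/
abbrev listGraph (T : List NatEdge) : XDigraph.{0, 0, 0} ℕ where
  V := ℕ
  E := {e // e ∈ T}
  o e := e.1.1
  t e := e.1.2.2
  μ e := e.1.2.1

/-- The subgroup generated by a list of words. -/
def wordSubgroup (A : List (List (ℕ × Bool))) : Subgroup (FreeGroup ℕ) :=
  Subgroup.closure {g | ∃ l ∈ A, g = FreeGroup.mk l}

/-- A folded finite graph with a vertex and closed paths there that represent the words in `A`. -/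
def IsReadingGraph (A : List (List (ℕ × Bool)))
    (c : ℕ × List NatEdge × List (List (NatEdge × Bool))) : Prop :=
  (∀ e ∈ c.2.1, ∀ f ∈ c.2.1, (e.1 = f.1 ∨ e.2.2 = f.2.2) → e.2.1 = f.2.1 → e = f) ∧
    ∀ l ∈ A, ∃ p ∈ c.2.2, (∀ a ∈ p, a.1 ∈ c.2.1) ∧
      c.1 :: p.map NatEdge.tgt = p.map NatEdge.src ++ [c.1] ∧
      FreeGroup.reduce (p.map NatEdge.label) = FreeGroup.reduce l

/-- A table of values that decrease along reduced paths in the product of two graphs. -/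
def IsRankTable (T U : List NatEdge) (W : List (((NatEdge × NatEdge) × Bool) × ℕ)) : Prop :=
  (∀ e ∈ T, ∀ f ∈ U, e.2.1 = f.2.1 →
    (∃ a ∈ W, a.1 = ((e, f), true)) ∧ ∃ a ∈ W, a.1 = ((e, f), false)) ∧
  ∀ a ∈ W, ∀ b ∈ W, NatEdge.src (b.1.1.1, b.1.2) = NatEdge.tgt (a.1.1.1, a.1.2) →
    NatEdge.src (b.1.1.2, b.1.2) = NatEdge.tgt (a.1.1.2, a.1.2) →
    b.1 ≠ (a.1.1, !a.1.2) → b.2 < a.2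

open XDigraph

theorem IsReadingGraph.isFolded {A : List (List (ℕ × Bool))}
    {c : ℕ × List NatEdge × List (List (NatEdge × Bool))} (h : IsReadingGraph A c) :
    (listGraph c.2.1).IsFolded :=
  ⟨fun e f ho hm => Subtype.ext (h.1 e.1 e.2 f.1 f.2 (Or.inl ho) hm),
    fun e f ht hm => Subtype.ext (h.1 e.1 e.2 f.1 f.2 (Or.inr ht) hm)⟩

theorem listGraph_src (T : List NatEdge) (a : (listGraph T).OEdge) :
    src a = NatEdge.src (a.1.1, a.2) := by
  rcases a with ⟨e, _ | _⟩ <;> rfl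

theorem listGraph_tgt (T : List NatEdge) (a : (listGraph T).OEdge) :
    tgt a = NatEdge.tgt (a.1.1, a.2) := by
  rcases a with ⟨e, _ | _⟩ <;> rfl

theorem listGraph_isPath_iff (T : List NatEdge) (p : List (listGraph T).OEdge) (x y : ℕ) :
    IsPath (Γ := listGraph T) x p y ↔
      x :: (p.map fun a => (a.1.1, a.2)).map NatEdge.tgt =
        (p.map fun a => (a.1.1, a.2)).map NatEdge.src ++ [y] := by
  induction p generalizing x with
  | nil => simp [IsPath]
  | cons a p ih =>
    simp only [IsPath, List.map_cons, List.cons_append, List.cons.injEq]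
    rw [ih, listGraph_src, listGraph_tgt, eq_comm (a := x)]

theorem IsReadingGraph.exists_isPath {A : List (List (ℕ × Bool))}
    {c : ℕ × List NatEdge × List (List (NatEdge × Bool))} (h : IsReadingGraph A c)
    {w : List (ℕ × Bool)} (hne : w ≠ []) (hc : FreeGroup.IsCyclicallyReduced w)
    (hx : ∃ x : FreeGroup ℕ ⧸ wordSubgroup A, (FreeGroup.mk w)⁻¹ • x = x) :
    ∃ (y : ℕ) (p : List (listGraph c.2.1).OEdge), IsPath (Γ := listGraph c.2.1) y p y ∧
      word p = w := by
  refine exists_isPath_of_generators h.isFolded c.1 _ ?_ hne hc hx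
  rintro _ ⟨l, hl, rfl⟩
  obtain ⟨p, -, hpT, hp, hw⟩ := h.2 l hl
  obtain ⟨q, rfl⟩ : ∃ q : List (listGraph c.2.1).OEdge, q.map (fun a => (a.1.1, a.2)) = p := by
    clear hp hw
    induction p with
    | nil => exact ⟨[], rfl⟩
    | cons a p ih =>
      obtain ⟨q, rfl⟩ := ih fun b hb => hpT b (List.mem_cons_of_mem _ hb)
      exact ⟨(⟨a.1, hpT a List.mem_cons_self⟩, a.2) :: q, rfl⟩
  refine ⟨q, (listGraph_isPath_iff _ _ _ _).2 hp, ?_⟩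
  rw [List.map_map] at hw
  exact FreeGroup.reduce.exact hw

/-- Soundness of the certificates. The graphs may read more than the subgroups: it suffices that
every cyclically reduced word conjugate into both would label a closed path in the product, which
the ranks forbid. -/
theorem not_haveCommonConjugate_of_isRankTable {A B : List (List (ℕ × Bool))}
    {c d : ℕ × List NatEdge × List (List (NatEdge × Bool))}
    {W : List (((NatEdge × NatEdge) × Bool) × ℕ)} (hc : IsReadingGraph A c)
    (hd : IsReadingGraph B d) (hW : IsRankTable c.2.1 d.2.1 W) :
    ¬ HaveCommonConjugate (wordSubgroup A) (wordSubgroup B) := by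
  intro h
  obtain ⟨w, hne, hw, hx, hy⟩ := exists_isCyclicallyReduced h
  obtain ⟨x, p, hp, hpw⟩ := hc.exists_isPath hne hw hx
  obtain ⟨y, q, hq, hqw⟩ := hd.exists_isPath hne hw hy
  obtain ⟨r, hr, hrw⟩ := exists_isPath_prod p q hp hq (hpw.trans hqw.symm)
  rw [hpw] at hrw
  -- The table may list several values for an oriented edge; the inequalities hold for all of them,
  -- so any choice gives a rank.
  have key : ∀ a : ((listGraph c.2.1).prod (listGraph d.2.1)).OEdge,
      ∃ b ∈ W, b.1 = ((a.1.1.1.1, a.1.1.2.1), a.2) := by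
    rintro ⟨⟨⟨e, f⟩, hl⟩, _ | _⟩
    · exact (hW.1 e.1 e.2 f.1 f.2 hl).2
    · exact (hW.1 e.1 e.2 f.1 f.2 hl).1
  choose Φ hΦ hΦ' using key
  have hsrc : ∀ a : ((listGraph c.2.1).prod (listGraph d.2.1)).OEdge,
      src a = (NatEdge.src (a.1.1.1.1, a.2), NatEdge.src (a.1.1.2.1, a.2)) := by
    rintro ⟨a, _ | _⟩ <;> rfl
  have htgt : ∀ a : ((listGraph c.2.1).prod (listGraph d.2.1)).OEdge,
      tgt a = (NatEdge.tgt (a.1.1.1.1, a.2), NatEdge.tgt (a.1.1.2.1, a.2)) := by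
    rintro ⟨a, _ | _⟩ <;> rfl
  have := eq_nil_of_rank (fun a => (Φ a).2) ?_ hr
    (chain_of_isCyclicallyReduced_word (hrw ▸ hw))
  · subst this
    exact hne hrw.symm
  · rintro a b ⟨h1, h2⟩
    rw [hsrc, htgt] at h1
    replace h1 := Prod.ext_iff.1 h1
    refine hW.2 _ (hΦ a) _ (hΦ b) ?_ ?_ ?_
    · rw [hΦ', hΦ']
      exact h1.1
    · rw [hΦ', hΦ']
      exact h1.2
    · rw [hΦ', hΦ']
      intro h3
      apply h2
      simp only [Prod.mk.injEq] at h3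
      exact Prod.ext (Subtype.ext (Prod.ext (Subtype.ext h3.1.1) (Subtype.ext h3.1.2))) h3.2

theorem wordSubgroup_fg (A : List (List (ℕ × Bool))) : (wordSubgroup A).FG := by
  rw [Subgroup.fg_iff]
  refine ⟨_, rfl, ?_⟩
  refine ((List.finite_toSet A).image FreeGroup.mk).subset ?_
  rintro _ ⟨l, hl, rfl⟩
  exact ⟨l, hl, rfl⟩

/-- The graph is `Γ(H)` with its vertices numbered. The last clause, needed for completeness of the
certificates, says that it reads nothing nontrivially closed beyond conjugates of elements of the
subgroup. -/
theorem exists_isReadingGraph (A : List (List (ℕ × Bool))) :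
    ∃ c, IsReadingGraph A c ∧ ∀ (y : ℕ) (p : List (listGraph c.2.1).OEdge),
      IsPath (Γ := listGraph c.2.1) y p y → p ≠ [] →
      ∃ x : FreeGroup ℕ ⧸ wordSubgroup A, (FreeGroup.mk (word p))⁻¹ • x = x := by
  classical
  set H := wordSubgroup A with hH
  obtain ⟨hV, hE⟩ := subgroupGraph_isFinite H (wordSubgroup_fg A)
  obtain ⟨n, ⟨ε⟩⟩ := hV.exists_equiv_fin
  let ι : (subgroupGraph H).V → ℕ := fun x => ε x
  have hι : Function.Injective ι := fun x y h => ε.injective (Fin.ext h)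
  let η : (subgroupGraph H).E → NatEdge := fun e =>
    (ι ((subgroupGraph H).o e), (subgroupGraph H).μ e, ι ((subgroupGraph H).t e))
  have hfold := (subgroupGraph_spec H).1
  obtain ⟨_⟩ := nonempty_fintype (subgroupGraph H).E
  let T : List NatEdge := (Finset.univ : Finset (subgroupGraph H).E).toList.map η
  have hT : ∀ e, e ∈ T ↔ ∃ f, η f = e := by simp [T]
  have hpath : ∀ l ∈ A, ∃ p : List (subgroupGraph H).OEdge,
      IsPath (subgroupGraphBase H) p (subgroupGraphBase H) ∧ word p = FreeGroup.reduce l := by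
    intro l hl
    have : FreeGroup.reduce l ∈ (subgroupGraph H).language (subgroupGraphBase H) := by
      rw [(subgroupGraph_spec H).2.2]
      refine ⟨FreeGroup.IsReduced.of_reduce_eq FreeGroup.reduce.idem, ?_⟩
      rw [FreeGroup.reduce.self]
      exact Subgroup.subset_closure ⟨l, hl, rfl⟩
    obtain ⟨p, hp, -, hw⟩ := this
    exact ⟨p, hp, hw⟩
  choose! P hP hPw using hpath
  let θ : (subgroupGraph H).OEdge → NatEdge × Bool := fun a => (η a.1, a.2)
  have hsrc : ∀ a, NatEdge.src (θ a) = ι (src a) := by rintro ⟨a, _ | _⟩ <;> rfl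
  have htgt : ∀ a, NatEdge.tgt (θ a) = ι (tgt a) := by rintro ⟨a, _ | _⟩ <;> rfl
  have hθ : ∀ (p : List (subgroupGraph H).OEdge) (x y), IsPath x p y →
      ι x :: (p.map θ).map NatEdge.tgt = (p.map θ).map NatEdge.src ++ [ι y] := by
    intro p
    induction p with
    | nil => rintro x y rfl; rfl
    | cons a p ih =>
      rintro x y ⟨rfl, hp⟩
      simp only [List.map_cons, List.cons_append, hsrc, htgt]
      rw [ih _ _ hp]
  refine ⟨(ι (subgroupGraphBase H), T, A.map fun l => (P l).map θ), ⟨?_, ?_⟩, ?_⟩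
  · intro e he f hf h h'
    obtain ⟨e, rfl⟩ := (hT _).1 he
    obtain ⟨f, rfl⟩ := (hT _).1 hf
    rcases h with h | h
    · rw [hfold.1 e f (hι h) h']
    · rw [hfold.2 e f (hι h) h']
  · intro l hl
    refine ⟨_, List.mem_map_of_mem hl, ?_, hθ _ _ _ (hP l hl), ?_⟩
    · intro a ha
      obtain ⟨b, -, rfl⟩ := List.mem_map.1 ha
      exact (hT _).2 ⟨_, rfl⟩
    · rw [List.map_map]
      change FreeGroup.reduce (word (P l)) = _
      rw [hPw l hl, FreeGroup.reduce.idem]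
  -- Listed edges come from edges of `Γ(H)`, and since the numbering of vertices is injective,
  -- consecutive ones still fit together there.
  · have lift : ∀ (p : List (listGraph T).OEdge) (x : (subgroupGraph H).V) (y : ℕ),
        IsPath (Γ := listGraph T) (ι x) p y → ∃ (z : (subgroupGraph H).V)
          (q : List (subgroupGraph H).OEdge), IsPath x q z ∧ ι z = y ∧ word q = word p := by
      intro p
      induction p with
      | nil => exact fun x y h => ⟨x, [], rfl, h, rfl⟩
      | cons a p ih =>
        rintro x y ⟨hs, hp⟩
        obtain ⟨⟨e, he⟩, b⟩ := a
        obtain ⟨f, rfl⟩ := (hT _).1 he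
        rw [listGraph_src] at hs
        rw [listGraph_tgt] at hp
        change IsPath (Γ := listGraph T) (NatEdge.tgt (θ (f, b))) p y at hp
        change NatEdge.src (θ (f, b)) = _ at hs
        rw [htgt] at hp
        rw [hsrc] at hs
        obtain ⟨z, q, hq, hz, hw⟩ := ih _ _ hp
        exact ⟨z, (f, b) :: q, ⟨hι hs, hq⟩, hz, congrArg (((subgroupGraph H).μ f, b) :: ·) hw⟩
    intro y p hp hne
    obtain ⟨x, rfl⟩ : ∃ x, ι x = y := by
      cases p with
      | nil => exact absurd rfl hne
      | cons a p =>
        obtain ⟨⟨e, he⟩, b⟩ := a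
        obtain ⟨f, rfl⟩ := (hT _).1 he
        have := hp.1
        rw [listGraph_src] at this
        exact ⟨_, (hsrc (f, b)).symm.trans this⟩
    obtain ⟨z, q, hq, hz, hw⟩ := lift p x _ hp
    obtain rfl := hι hz
    rw [← hw]
    exact smul_eq_of_isPath_subgroupGraph H hq

/-- Completeness of the certificates: in the product of the numbered graphs, a nontrivial reduced
closed path would read a common conjugate, so `exists_rank` applies. -/
theorem exists_isRankTable {A B : List (List (ℕ × Bool))}
    (h : ¬ HaveCommonConjugate (wordSubgroup A) (wordSubgroup B)) :
    ∃ c d W, IsReadingGraph A c ∧ IsReadingGraph B d ∧ IsRankTable c.2.1 d.2.1 W := by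
  obtain ⟨c, hc, hcp⟩ := exists_isReadingGraph A
  obtain ⟨d, hd, hdp⟩ := exists_isReadingGraph B
  set Δ := (listGraph c.2.1).prod (listGraph d.2.1) with hΔ
  have hfin : Finite Δ.E :=
    inferInstanceAs (Finite {a : {e // e ∈ c.2.1} × {e // e ∈ d.2.1} // a.1.1.2.1 = a.2.1.2.1})
  obtain ⟨Φ, hΦ⟩ := exists_rank (Δ := Δ) (by
    rintro ⟨x, y⟩ r hr hred
    by_contra hne
    obtain ⟨⟨p, hp, hpw⟩, q, hq, hqw⟩ := exists_isPath_of_prod r hr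
    have hwne : word r ≠ [] := by simpa [word] using hne
    have hx := hcp x p hp (by rintro rfl; exact hwne hpw.symm)
    have hy := hdp y q hq (by rintro rfl; exact hwne hqw.symm)
    rw [hpw] at hx
    rw [hqw] at hy
    exact h (haveCommonConjugate_of_word hwne ((isReduced_word_iff
      (prod_isFolded hc.isFolded hd.isFolded) r _ _ hr).2 hred) hx hy))
  obtain ⟨_⟩ := nonempty_fintype Δ.OEdge
  let τ : Δ.OEdge → ((NatEdge × NatEdge) × Bool) × ℕ := fun a =>
    (((a.1.1.1.1, a.1.1.2.1), a.2), Φ a)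
  refine ⟨c, d, (Finset.univ : Finset Δ.OEdge).toList.map τ, hc, hd, ?_, ?_⟩
  · intro e he f hf hl
    have : ∀ b : Bool, ∃ a ∈ (Finset.univ : Finset Δ.OEdge).toList.map τ, a.1 = ((e, f), b) :=
      fun b => ⟨τ (⟨(⟨e, he⟩, ⟨f, hf⟩), hl⟩, b), List.mem_map_of_mem (by simp), rfl⟩
    exact ⟨this true, this false⟩
  · intro a ha b hb
    obtain ⟨a, -, rfl⟩ := List.mem_map.1 ha
    obtain ⟨b, -, rfl⟩ := List.mem_map.1 hb
    intro h1 h2 h3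
    refine hΦ a b ⟨?_, ?_⟩
    · obtain ⟨a, _ | _⟩ := a <;> obtain ⟨b, _ | _⟩ := b <;> exact Prod.ext h1 h2
    · rintro rfl
      exact h3 rfl

/-! ### Certificates can be checked primitive recursively; decidability by Post's theorem -/

section Computability

variable {α β γ : Type*} [Primcodable α] [Primcodable β] [Primcodable γ]

theorem PrimrecPred.forall_mem {f : α → List β} {p : α → β → Prop} (hf : Primrec f)
    (hp : PrimrecPred fun x : α × β => p x.1 x.2) : PrimrecPred fun a => ∀ b ∈ f a, p a b := by
  have hR : PrimrecRel fun (b : β) (a : α) => p a b :=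
    PrimrecPred.comp hp (Primrec.snd.pair Primrec.fst)
  exact hR.forall_mem_list.comp hf Primrec.id

theorem PrimrecPred.exists_mem {f : α → List β} {p : α → β → Prop} (hf : Primrec f)
    (hp : PrimrecPred fun x : α × β => p x.1 x.2) : PrimrecPred fun a => ∃ b ∈ f a, p a b := by
  have hR : PrimrecRel fun (b : β) (a : α) => p a b :=
    PrimrecPred.comp hp (Primrec.snd.pair Primrec.fst)
  exact hR.exists_mem_list.comp hf Primrec.id

theorem PrimrecPred.imp {p q : α → Prop} (hp : PrimrecPred p) (hq : PrimrecPred q) :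
    PrimrecPred fun a => p a → q a :=
  (hp.not.or hq).of_eq fun _ => imp_iff_not_or.symm

theorem PrimrecPred.mem {f : α → β} {g : α → List β} (hf : Primrec f) (hg : Primrec g) :
    PrimrecPred fun a => f a ∈ g a :=
  (PrimrecPred.exists_mem (p := fun a b => b = f a) hg (Primrec.eq.comp Primrec.snd (hf.comp Primrec.fst))).of_eq
    fun a => by simp

/-- The projection of a primitive recursive relation is recursively enumerable. -/
theorem PrimrecPred.exists_rePred {p : α × γ → Prop} (hp : PrimrecPred p) :
    REPred fun a => ∃ c, p (a, c) := by
  classical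
  -- Unbounded search through the codes `n` of possible witnesses; numbers that code nothing give
  -- `none`.
  have hf : Primrec₂ fun (a : α) (n : ℕ) =>
      (Encodable.decode n : Option γ).bind fun c => if p (a, c) then some () else none :=
    Primrec.option_bind (Primrec.decode.comp Primrec.snd)
      (Primrec.ite (hp.comp ((Primrec.fst.comp Primrec.fst).pair Primrec.snd))
        (Primrec.const _) (Primrec.const _))
  refine (Partrec.dom_re (Partrec.rfindOpt hf.to_comp)).of_eq fun a => ?_
  rw [Nat.rfindOpt_dom]
  constructor
  · rintro ⟨n, _, h⟩
    rw [Option.mem_def, Option.bind_eq_some_iff] at h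
    obtain ⟨c, -, hc⟩ := h
    by_contra hne
    rw [if_neg fun h => hne ⟨c, h⟩] at hc
    cases hc
  · rintro ⟨c, hc⟩
    exact ⟨Encodable.encode c, (), by simp [hc]⟩

theorem primrec_invRev : Primrec (FreeGroup.invRev : List (ℕ × Bool) → List (ℕ × Bool)) :=
  Primrec.list_reverse.comp (Primrec.list_map Primrec.id
    (((Primrec.fst.comp Primrec.snd).pair
      (Primrec.not.comp (Primrec.snd.comp Primrec.snd)))).to₂)

/-- As a fold with a cancelling push, free reduction is visibly primitive recursive. -/
theorem reduce_eq_foldr (l : List (ℕ × Bool)) :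
    FreeGroup.reduce l =
      l.foldr (fun a m => if m.head? = some (a.1, !a.2) then m.tail else a :: m) [] := by
  induction l with
  | nil => rfl
  | cons a l ih =>
    rw [FreeGroup.reduce.cons, ih, List.foldr_cons]
    generalize List.foldr _ [] l = m
    cases m with
    | nil => simp
    | cons b m =>
      obtain ⟨x, c⟩ := a
      obtain ⟨y, d⟩ := b
      by_cases hxy : x = y <;> cases c <;> cases d <;> simp [hxy, eq_comm]

theorem primrec_reduce : Primrec (FreeGroup.reduce : List (ℕ × Bool) → List (ℕ × Bool)) := by
  refine Primrec.of_eq (f := fun l : List (ℕ × Bool) =>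
    l.foldr (fun a m => if m.head? = some (a.1, !a.2) then m.tail else a :: m) []) ?_
    fun l => (reduce_eq_foldr l).symm
  refine Primrec.list_foldr (h := fun _ (x : (ℕ × Bool) × List (ℕ × Bool)) =>
    if x.2.head? = some (x.1.1, !x.1.2) then x.2.tail else x.1 :: x.2)
    Primrec.id (Primrec.const []) ?_
  have h1 : Primrec fun y : List (ℕ × Bool) × (ℕ × Bool) × List (ℕ × Bool) => y.2.1 :=
    Primrec.fst.comp Primrec.snd
  have h2 : Primrec fun y : List (ℕ × Bool) × (ℕ × Bool) × List (ℕ × Bool) => y.2.2 :=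
    Primrec.snd.comp Primrec.snd
  exact Primrec.ite (Primrec.eq.comp (Primrec.list_head?.comp h2)
      (Primrec.option_some.comp ((Primrec.fst.comp h1).pair
        (Primrec.not.comp (Primrec.snd.comp h1)))))
    (Primrec.list_tail.comp h2) (Primrec.list_cons.comp h1 h2)

theorem NatEdge.primrec_src : Primrec NatEdge.src :=
  Primrec.cond Primrec.snd (Primrec.fst.comp Primrec.fst)
    (Primrec.snd.comp (Primrec.snd.comp Primrec.fst))

theorem NatEdge.primrec_tgt : Primrec NatEdge.tgt :=
  Primrec.cond Primrec.snd (Primrec.snd.comp (Primrec.snd.comp Primrec.fst))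
    (Primrec.fst.comp Primrec.fst)

theorem NatEdge.primrec_label : Primrec NatEdge.label :=
  (Primrec.fst.comp (Primrec.snd.comp Primrec.fst)).pair Primrec.snd

theorem primrecPred_isReadingGraph :
    PrimrecPred fun x : List (List (ℕ × Bool)) ×
      ℕ × List NatEdge × List (List (NatEdge × Bool)) => IsReadingGraph x.1 x.2 := by
  refine PrimrecPred.and ?_ ?_
  · have hT : Primrec fun x : List (List (ℕ × Bool)) ×
      ℕ × List NatEdge × List (List (NatEdge × Bool)) => x.2.2.1 :=
      Primrec.fst.comp (Primrec.snd.comp Primrec.snd)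
    refine PrimrecPred.forall_mem hT (PrimrecPred.forall_mem (hT.comp Primrec.fst) ?_)
    have he : Primrec fun x : ((List (List (ℕ × Bool)) ×
      ℕ × List NatEdge × List (List (NatEdge × Bool))) × NatEdge) × NatEdge => x.1.2 :=
      Primrec.snd.comp Primrec.fst
    have hf : Primrec fun x : ((List (List (ℕ × Bool)) ×
      ℕ × List NatEdge × List (List (NatEdge × Bool))) × NatEdge) × NatEdge => x.2 :=
      Primrec.snd
    have h2 : Primrec fun e : NatEdge => e.2.1 := Primrec.fst.comp Primrec.snd
    have h3 : Primrec fun e : NatEdge => e.2.2 := Primrec.snd.comp Primrec.snd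
    refine PrimrecPred.imp (PrimrecPred.or ?_ ?_) (PrimrecPred.imp ?_ (Primrec.eq.comp he hf))
    · exact Primrec.eq.comp (Primrec.fst.comp he) (Primrec.fst.comp hf)
    · exact Primrec.eq.comp (h3.comp he) (h3.comp hf)
    · exact Primrec.eq.comp (h2.comp he) (h2.comp hf)
  · refine PrimrecPred.forall_mem Primrec.fst (PrimrecPred.exists_mem
      (Primrec.snd.comp (Primrec.snd.comp (Primrec.snd.comp Primrec.fst))) ?_)
    have hp : Primrec fun x : ((List (List (ℕ × Bool)) × ℕ × List NatEdge ×
      List (List (NatEdge × Bool))) × List (ℕ × Bool)) × List (NatEdge × Bool) => x.2 :=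
      Primrec.snd
    have hl : Primrec fun x : ((List (List (ℕ × Bool)) × ℕ × List NatEdge ×
      List (List (NatEdge × Bool))) × List (ℕ × Bool)) × List (NatEdge × Bool) => x.1.2 :=
      Primrec.snd.comp Primrec.fst
    have hc : Primrec fun x : ((List (List (ℕ × Bool)) × ℕ × List NatEdge ×
      List (List (NatEdge × Bool))) × List (ℕ × Bool)) × List (NatEdge × Bool) => x.1.1.2 :=
      Primrec.snd.comp (Primrec.fst.comp Primrec.fst)
    refine PrimrecPred.and ?_ (PrimrecPred.and ?_ ?_)
    · exact PrimrecPred.forall_mem hp (PrimrecPred.mem (Primrec.fst.comp Primrec.snd)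
        (Primrec.fst.comp (Primrec.snd.comp (hc.comp Primrec.fst))))
    · exact Primrec.eq.comp
        (Primrec.list_cons.comp (Primrec.fst.comp hc)
          (Primrec.list_map hp (NatEdge.primrec_tgt.comp Primrec.snd).to₂))
        (Primrec.list_append.comp
          (Primrec.list_map hp (NatEdge.primrec_src.comp Primrec.snd).to₂)
          (Primrec.list_cons.comp (Primrec.fst.comp hc) (Primrec.const [])))
    · exact Primrec.eq.comp
        (primrec_reduce.comp (Primrec.list_map hp (NatEdge.primrec_label.comp Primrec.snd).to₂))
        (primrec_reduce.comp hl)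

theorem primrecPred_isRankTable :
    PrimrecPred fun x : List NatEdge × List NatEdge × List (((NatEdge × NatEdge) × Bool) × ℕ) =>
      IsRankTable x.1 x.2.1 x.2.2 := by
  refine PrimrecPred.and ?_ ?_
  · refine PrimrecPred.forall_mem Primrec.fst (PrimrecPred.forall_mem
      (Primrec.fst.comp (Primrec.snd.comp Primrec.fst)) ?_)
    have he : Primrec fun x : ((List NatEdge × List NatEdge ×
      List (((NatEdge × NatEdge) × Bool) × ℕ)) × NatEdge) × NatEdge => x.1.2 :=
      Primrec.snd.comp Primrec.fst
    have hf : Primrec fun x : ((List NatEdge × List NatEdge ×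
      List (((NatEdge × NatEdge) × Bool) × ℕ)) × NatEdge) × NatEdge => x.2 := Primrec.snd
    have hW : Primrec fun x : ((List NatEdge × List NatEdge ×
      List (((NatEdge × NatEdge) × Bool) × ℕ)) × NatEdge) × NatEdge => x.1.1.2.2 :=
      Primrec.snd.comp (Primrec.snd.comp (Primrec.fst.comp Primrec.fst))
    have h2 : Primrec fun e : NatEdge => e.2.1 := Primrec.fst.comp Primrec.snd
    refine PrimrecPred.imp (Primrec.eq.comp (h2.comp he) (h2.comp hf)) (PrimrecPred.and ?_ ?_) <;>
    exact PrimrecPred.exists_mem hW (Primrec.eq.comp (Primrec.fst.comp Primrec.snd)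
      (((he.pair hf).comp Primrec.fst).pair (Primrec.const _)))
  · have hW : Primrec fun x : List NatEdge × List NatEdge ×
      List (((NatEdge × NatEdge) × Bool) × ℕ) => x.2.2 := Primrec.snd.comp Primrec.snd
    refine PrimrecPred.forall_mem hW (PrimrecPred.forall_mem (hW.comp Primrec.fst) ?_)
    have ha : Primrec fun x : ((List NatEdge × List NatEdge ×
      List (((NatEdge × NatEdge) × Bool) × ℕ)) × (((NatEdge × NatEdge) × Bool) × ℕ)) ×
      (((NatEdge × NatEdge) × Bool) × ℕ) => x.1.2 := Primrec.snd.comp Primrec.fst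
    have hb : Primrec fun x : ((List NatEdge × List NatEdge ×
      List (((NatEdge × NatEdge) × Bool) × ℕ)) × (((NatEdge × NatEdge) × Bool) × ℕ)) ×
      (((NatEdge × NatEdge) × Bool) × ℕ) => x.2 := Primrec.snd
    have h1 : Primrec fun a : ((NatEdge × NatEdge) × Bool) × ℕ => (a.1.1.1, a.1.2) :=
      (Primrec.fst.comp (Primrec.fst.comp Primrec.fst)).pair (Primrec.snd.comp Primrec.fst)
    have h2 : Primrec fun a : ((NatEdge × NatEdge) × Bool) × ℕ => (a.1.1.2, a.1.2) :=
      (Primrec.snd.comp (Primrec.fst.comp Primrec.fst)).pair (Primrec.snd.comp Primrec.fst)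
    have h3 : Primrec fun a : ((NatEdge × NatEdge) × Bool) × ℕ => (a.1.1, !a.1.2) :=
      (Primrec.fst.comp Primrec.fst).pair (Primrec.not.comp (Primrec.snd.comp Primrec.fst))
    refine PrimrecPred.imp ?_ (PrimrecPred.imp ?_ (PrimrecPred.imp ?_ ?_))
    · exact Primrec.eq.comp (NatEdge.primrec_src.comp (h1.comp hb))
        (NatEdge.primrec_tgt.comp (h1.comp ha))
    · exact Primrec.eq.comp (NatEdge.primrec_src.comp (h2.comp hb))
        (NatEdge.primrec_tgt.comp (h2.comp ha))
    · exact (Primrec.eq.comp (Primrec.fst.comp hb) (h3.comp ha)).not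
    · exact Primrec.nat_lt.comp (Primrec.snd.comp hb) (Primrec.snd.comp ha)

theorem rePred_not_haveCommonConjugate :
    REPred fun x : List (List (ℕ × Bool)) × List (List (ℕ × Bool)) =>
      ¬ HaveCommonConjugate (wordSubgroup x.1) (wordSubgroup x.2) := by
  have h : PrimrecPred fun x : (List (List (ℕ × Bool)) × List (List (ℕ × Bool))) ×
      (ℕ × List NatEdge × List (List (NatEdge × Bool))) ×
      (ℕ × List NatEdge × List (List (NatEdge × Bool))) ×
      List (((NatEdge × NatEdge) × Bool) × ℕ) =>
      IsReadingGraph x.1.1 x.2.1 ∧ IsReadingGraph x.1.2 x.2.2.1 ∧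
        IsRankTable x.2.1.2.1 x.2.2.1.2.1 x.2.2.2 := by
    refine PrimrecPred.and ?_ (PrimrecPred.and ?_ ?_)
    · exact primrecPred_isReadingGraph.comp
        ((Primrec.fst.comp Primrec.fst).pair (Primrec.fst.comp Primrec.snd))
    · exact primrecPred_isReadingGraph.comp
        ((Primrec.snd.comp Primrec.fst).pair (Primrec.fst.comp (Primrec.snd.comp Primrec.snd)))
    · exact primrecPred_isRankTable.comp
        ((Primrec.fst.comp (Primrec.snd.comp (Primrec.fst.comp Primrec.snd))).pair
          ((Primrec.fst.comp (Primrec.snd.comp (Primrec.fst.comp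
            (Primrec.snd.comp Primrec.snd)))).pair
            (Primrec.snd.comp (Primrec.snd.comp Primrec.snd))))
  refine h.exists_rePred.of_eq fun x => ⟨?_, fun hx => ?_⟩
  · rintro ⟨c, h1, h2, h3⟩
    exact not_haveCommonConjugate_of_isRankTable h1 h2 h3
  · obtain ⟨c, d, W, h⟩ := exists_isRankTable hx
    exact ⟨(c, d, W), h⟩

/-- Membership gets a finite witness, a list of generators and inverses, whose validity is
decidable. -/
theorem mem_wordSubgroup_iff (A : List (List (ℕ × Bool))) (g : FreeGroup ℕ) :
    g ∈ wordSubgroup A ↔ ∃ L : List (List (ℕ × Bool)),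
      (∀ l ∈ L, l ∈ A ∨ FreeGroup.invRev l ∈ A) ∧ FreeGroup.mk L.flatten = g := by
  constructor
  · intro hg
    induction hg using Subgroup.closure_induction with
    | mem g hg =>
      obtain ⟨l, hl, rfl⟩ := hg
      exact ⟨[l], by simp [hl], by simp⟩
    | one => exact ⟨[], by simp, rfl⟩
    | mul g h _ _ hg hh =>
      obtain ⟨L, hL, rfl⟩ := hg
      obtain ⟨M, hM, rfl⟩ := hh
      refine ⟨L ++ M, ?_, by rw [List.flatten_append, FreeGroup.mul_mk]⟩
      intro l hl
      exact (List.mem_append.1 hl).elim (hL l) (hM l)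
    | inv g _ hg =>
      obtain ⟨L, hL, rfl⟩ := hg
      refine ⟨(L.map FreeGroup.invRev).reverse, ?_, ?_⟩
      · intro l hl
        rw [List.mem_reverse, List.mem_map] at hl
        obtain ⟨m, hm, rfl⟩ := hl
        rw [FreeGroup.invRev_invRev]
        exact (hL m hm).symm
      · rw [FreeGroup.inv_mk]
        have : ∀ L : List (List (ℕ × Bool)),
            (L.map FreeGroup.invRev).reverse.flatten = FreeGroup.invRev L.flatten := by
          intro L
          induction L with
          | nil => rfl
          | cons l L ih => simp [ih]
        rw [this]
  · rintro ⟨L, hL, rfl⟩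
    induction L with
    | nil => exact one_mem _
    | cons l L ih =>
      rw [List.flatten_cons, ← FreeGroup.mul_mk]
      refine mul_mem ?_ (ih fun m hm => hL m (List.mem_cons_of_mem _ hm))
      rcases hL l List.mem_cons_self with h | h
      · exact Subgroup.subset_closure ⟨l, h, rfl⟩
      · rw [← inv_mem_iff, FreeGroup.inv_mk]
        exact Subgroup.subset_closure ⟨_, h, rfl⟩

theorem primrecPred_forall_mem_or {f g : α → List (List (ℕ × Bool))} (hf : Primrec f)
    (hg : Primrec g) :
    PrimrecPred fun x => ∀ l ∈ f x, l ∈ g x ∨ FreeGroup.invRev l ∈ g x :=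
  PrimrecPred.forall_mem hf
    ((PrimrecPred.mem Primrec.snd (hg.comp Primrec.fst)).or
      (PrimrecPred.mem (primrec_invRev.comp Primrec.snd) (hg.comp Primrec.fst)))

theorem rePred_haveCommonConjugate :
    REPred fun x : List (List (ℕ × Bool)) × List (List (ℕ × Bool)) =>
      HaveCommonConjugate (wordSubgroup x.1) (wordSubgroup x.2) := by
  -- A witness consists of a conjugator `u` and spellings `L`, `M` of elements of the two subgroups.
  -- The common conjugate can be taken to be the element spelled by `L`, so only its nontriviality
  -- and one conjugation identity need checking.
  have h : PrimrecPred fun x : (List (List (ℕ × Bool)) × List (List (ℕ × Bool))) ×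
      List (ℕ × Bool) × List (List (ℕ × Bool)) × List (List (ℕ × Bool)) =>
      (∀ l ∈ x.2.2.1, l ∈ x.1.1 ∨ FreeGroup.invRev l ∈ x.1.1) ∧
      (∀ l ∈ x.2.2.2, l ∈ x.1.2 ∨ FreeGroup.invRev l ∈ x.1.2) ∧
      FreeGroup.reduce x.2.2.1.flatten ≠ [] ∧
      FreeGroup.reduce (x.2.1 ++ x.2.2.1.flatten ++ FreeGroup.invRev x.2.1) =
        FreeGroup.reduce x.2.2.2.flatten := by
    have hu : Primrec fun x : (List (List (ℕ × Bool)) × List (List (ℕ × Bool))) ×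
      List (ℕ × Bool) × List (List (ℕ × Bool)) × List (List (ℕ × Bool)) => x.2.1 :=
      Primrec.fst.comp Primrec.snd
    have hL : Primrec fun x : (List (List (ℕ × Bool)) × List (List (ℕ × Bool))) ×
      List (ℕ × Bool) × List (List (ℕ × Bool)) × List (List (ℕ × Bool)) => x.2.2.1 :=
      Primrec.fst.comp (Primrec.snd.comp Primrec.snd)
    have hM : Primrec fun x : (List (List (ℕ × Bool)) × List (List (ℕ × Bool))) ×
      List (ℕ × Bool) × List (List (ℕ × Bool)) × List (List (ℕ × Bool)) => x.2.2.2 :=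
      Primrec.snd.comp (Primrec.snd.comp Primrec.snd)
    refine PrimrecPred.and ?_ (PrimrecPred.and ?_ (PrimrecPred.and (PrimrecPred.not ?_) ?_))
    · exact primrecPred_forall_mem_or hL (Primrec.fst.comp Primrec.fst)
    · exact primrecPred_forall_mem_or hM (Primrec.snd.comp Primrec.fst)
    · exact Primrec.eq.comp (primrec_reduce.comp (Primrec.list_flatten.comp hL))
        (Primrec.const [])
    · exact Primrec.eq.comp (primrec_reduce.comp (Primrec.list_append.comp
        (Primrec.list_append.comp hu (Primrec.list_flatten.comp hL)) (primrec_invRev.comp hu)))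
        (primrec_reduce.comp (Primrec.list_flatten.comp hM))
  refine h.exists_rePred.of_eq fun x => ⟨?_, ?_⟩
  · rintro ⟨⟨u, L, M⟩, hL, hM, hne, heq⟩
    refine ⟨FreeGroup.mk L.flatten, ?_, ⟨_, (mem_wordSubgroup_iff _ _).2 ⟨L, hL, rfl⟩,
      IsConj.refl _⟩, ⟨_, (mem_wordSubgroup_iff _ _).2 ⟨M, hM, rfl⟩, isConj_iff.2
      ⟨FreeGroup.mk u, ?_⟩⟩⟩
    · exact fun h => hne (FreeGroup.reduce.sound h)
    · rw [FreeGroup.inv_mk, FreeGroup.mul_mk, FreeGroup.mul_mk]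
      exact FreeGroup.reduce.exact heq
  · rintro ⟨g, hg, ⟨a, ha, hga⟩, b, hb, hgb⟩
    obtain ⟨L, hL, rfl⟩ := (mem_wordSubgroup_iff _ _).1 ha
    obtain ⟨M, hM, rfl⟩ := (mem_wordSubgroup_iff _ _).1 hb
    obtain ⟨c, hc⟩ := isConj_iff.1 (hga.symm.trans hgb)
    refine ⟨(c.toWord, L, M), hL, hM, ?_, ?_⟩
    · intro h
      have h1 : FreeGroup.mk L.flatten = 1 := FreeGroup.reduce.exact h
      rw [h1] at hga
      exact hg (isConj_one_left.1 hga)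
    · refine FreeGroup.reduce.sound ?_
      rw [← FreeGroup.mul_mk, ← FreeGroup.mul_mk, ← FreeGroup.inv_mk, FreeGroup.mk_toWord]
      exact hc

theorem computablePred_haveCommonConjugate :
    ComputablePred fun x : List (List (ℕ × Bool)) × List (List (ℕ × Bool)) =>
      HaveCommonConjugate (wordSubgroup x.1) (wordSubgroup x.2) :=
  ComputablePred.computable_iff_re_compl_re'.2
    ⟨rePred_haveCommonConjugate, rePred_not_haveCommonConjugate⟩

end Computability

/-! ### From a basis indexed by `Fin n` to letters in `ℕ` -/

theorem haveCommonConjugate_natWords {n : ℕ} {F : Type v} [Group F] (b : FreeGroupBasis (Fin n) F)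
    (A B : List (List (Fin n × Bool))) :
    HaveCommonConjugate (wordSubgroup (natWords A)) (wordSubgroup (natWords B)) ↔
      HaveCommonConjugate (subgroupOfWords b A) (subgroupOfWords b B) := by
  let φ : F →* FreeGroup ℕ := (FreeGroup.map Fin.val).comp b.repr.toMonoidHom
  -- A retraction of the embedding `φ` that kills the letters from `n` on. It carries common
  -- conjugates back to `F`, being injective on the image of `φ`.
  let ρ : FreeGroup ℕ →* F :=
    FreeGroup.lift fun k => if h : k < n then b.repr.symm (FreeGroup.of ⟨k, h⟩) else 1
  have hρφ : ρ.comp φ = MonoidHom.id F := by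
    have : ρ.comp (FreeGroup.map Fin.val) = b.repr.symm.toMonoidHom :=
      FreeGroup.ext_hom _ _ fun i => by simp [ρ]
    ext g
    have h := DFunLike.congr_fun this (b.repr g)
    simpa [φ] using h
  have hinj : Function.Injective φ := fun g h hgh => by
    have := congrArg ρ hgh
    rwa [← MonoidHom.comp_apply, ← MonoidHom.comp_apply, hρφ] at this
  have hmap : ∀ A : List (List (Fin n × Bool)),
      (subgroupOfWords b A).map φ = wordSubgroup (natWords A) := by
    intro A
    rw [subgroupOfWords, MonoidHom.map_closure, wordSubgroup]
    congr 1
    ext g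
    constructor
    · rintro ⟨_, ⟨l, hl, rfl⟩, rfl⟩
      exact ⟨_, List.mem_map_of_mem hl, by simp [φ]⟩
    · rintro ⟨_, hl, rfl⟩
      obtain ⟨l, hl', rfl⟩ := List.mem_map.1 hl
      exact ⟨_, ⟨l, hl', rfl⟩, by simp [φ]⟩
  rw [← hmap, ← hmap]
  constructor
  · intro h
    have := h.map ρ (by
      rintro _ ⟨g, -, rfl⟩ hg h1
      rw [← MonoidHom.comp_apply, hρφ, MonoidHom.id_apply] at h1
      exact hg (by rw [h1, map_one]))
    rwa [Subgroup.map_map, Subgroup.map_map, hρφ, Subgroup.map_id, Subgroup.map_id] at this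
  · exact fun h => h.map φ fun g _ hg h1 => hg (hinj (h1.trans (map_one φ).symm))

theorem mainTheorem2 :
    (∀ {F : Type v} [Group F] {X : Type u} [Finite X] (b : FreeGroupBasis X F)
      (H K : Subgroup F), H.FG → K.FG →
        (XDigraph.subgroupGraphOfBasis b H).type.IsFinite ∧
        (XDigraph.subgroupGraphOfBasis b K).type.IsFinite ∧
        ((XDigraph.subgroupGraphOfBasis b H).type.prod
          (XDigraph.subgroupGraphOfBasis b K).type).IsFinite ∧
        (HaveCommonConjugate H K ↔
          ((XDigraph.subgroupGraphOfBasis b H).type.prod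
            (XDigraph.subgroupGraphOfBasis b K).type).HasCycle)) ∧
    ∃ f : ℕ × List (List (ℕ × Bool)) × List (List (ℕ × Bool)) → Bool, Computable f ∧
      ∀ (n : ℕ) {F : Type v} [Group F] (b : FreeGroupBasis (Fin n) F)
        (A B : List (List (Fin n × Bool))),
        f (n, natWords A, natWords B) = true ↔
          HaveCommonConjugate (subgroupOfWords b A) (subgroupOfWords b B) := by
  constructor
  · intro F _ X _ b H K hH hK
    have hfin : ∀ H : Subgroup F, H.FG → (XDigraph.subgroupGraphOfBasis b H).type.IsFinite :=
      fun H hH => XDigraph.type_isFinite (XDigraph.subgroupGraph_isFinite _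
        ((Subgroup.fg_iff_submonoid_fg _).2
          (((Subgroup.fg_iff_submonoid_fg H).1 hH).map b.repr.toMonoidHom)))
    refine ⟨hfin H hH, hfin K hK, XDigraph.prod_isFinite (hfin H hH) (hfin K hK), ?_⟩
    rw [← haveCommonConjugate_map_mulEquiv b.repr]
    exact XDigraph.haveCommonConjugate_iff_hasCycle _ _
  · obtain ⟨_, hf⟩ := computablePred_haveCommonConjugate
    -- The algorithm discards `n`: unused letters do not affect the answer in the free group on `ℕ`.
    refine ⟨_, hf.comp Computable.snd, fun n F _ b A B => ?_⟩
    rw [decide_eq_true_iff]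
    exact haveCommonConjugate_natWords b A B
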